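/- **Setting.** Let $\alpha, b\in(0,1)$. There is a continuum of students whose types $\theta\in(0,\alpha)$ are distributed according to an atomless probability distribution $F$ with $\operatorname{supp}F=[0,\alpha]$. A student of type $\theta$ choosing effort $e\in[0,1-\alpha]$ has productive value $1$ with probability $\theta+e$ and $0$ otherwise, and bears the cost $c(e)$, where $c$ is three times differentiable on $[0,1-\alpha]$ with $c'>0$ and $c''>0$ on $(0,1-\alpha]$, $c'''\ge 0$, $c'(0)=0$ and $c'(1-\alpha)>1$. A grading rule is a pair $G=(g^0,g^1)\in[0,1]^2$ with $0<g^1-g^0\le b$: a student of productive value $i$ obtains the grade "pass" with probability $g^i$, and "fail" otherwise. Put $G_\star=(1-b,1)$ and $G^\star=(0,b)$. A school system consists of $n\in\mathbb N$, a measurable map $\phi:(0,\alpha)\to\{1,\dots,n\}$ with $m_s:=F(\phi^{-1}(s))>0$ for all $s$, and grading rules $G_1,\dots,G_n$, $G_s=(g_s^0,g_s^1)$. Let $\bar\theta_s=\frac1{m_s}\int_{\phi^{-1}(s)}\theta\,dF(\theta)$. If employers conjecture effort $\hat e$ in school $s$, they pay a wage equal to the posterior belief that the productive value is $1$ given the school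 and the grade; with $x=\bar\theta_s+\hat e$ this is $$q_s^+(\hat e)=\frac{x g_s^1}{x g_s^1+(1-x)g_s^0},\qquad q_s^-(\hat e)=\frac{x(1-g_s^1)}{x(1-g_s^1)+(1-x)(1-g_s^0)}$$ after pass and fail respectively. With $p=(\theta+e)g_s^1+(1-\theta-e)g_s^0$, the expected payoff of type $\theta$ is $U_s(\theta,e,\hat e)=p\,q_s^+(\hat e)+(1-p)\,q_s^-(\hat e)-c(e)$. The equilibrium effort $e_s^*$ of school $s$ is the (unique) $e\in[0,1-\alpha]$ that maximizes $U_s(\theta,\cdot,e)$ over $[0,1-\alpha]$ for the students of $s$. Let $U_s^*(\theta)=U_s(\theta,e_s^*,e_s^*)$. Social welfare is $W=\sum_{s=1}^n m_s[\bar\theta_s+e_s^*-c(e_s^*)]$. A school system is incentive compatible with transfers if there are fees $t_1,\dots,t_n\in\mathbb R$ such that $U^*_{\phi(\theta)}(\theta)-t_{\phi(\theta)}=\max_s\,(U^*_s(\theta)-t_s)$ for every $\theta\in(0,\alpha)$. It is constrained optimal if it maximizes $W$ among all school systems that are incentive compatible with transfers. It has a single-tier structure if $\bar\theta_s=\bar\theta_{s'}$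 for all schools $s,s'$. It has a two-tier structure, with bottom tier $S$ and top tier $S'$, if $S,S'$ are non-empty and partition $\{1,\dots,n\}$, $\bar\theta_s$ is constant on $S$ and constant on $S'$ with a strictly smaller value on $S$, and, outside an $F$-null set of types, $\theta\le\theta'$ whenever $\phi(\theta)\in S$ and $\phi(\theta')\in S'$. **Theorem.** Every constrained-optimal school system has either a single-tier structure or a two-tier structure. In the latter case, schools in the top tier have grading rule $G_\star$, and schools in the bottom tier have grading rule $G^\star$. -/

import Mathlib

open Set MeasureTheory

noncomputable section

/-- A cost-of-effort function on `[0, 1 - α]`: three times differentiable, with `c' > 0` and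
`c'' > 0` at positive efforts, `c''' ≥ 0`, `c'(0) = 0` and `c'(1 - α) > 1`.
Derivatives are taken within `[0, 1 - α]`, hence one-sided at the endpoints. -/
structure IsCostFunction (α : ℝ) (c : ℝ → ℝ) : Prop where
  diff : ∀ k : ℕ, k < 3 →
    DifferentiableOn ℝ (iteratedDerivWithin k c (Icc 0 (1 - α))) (Icc 0 (1 - α))
  deriv_pos : ∀ e ∈ Ioc 0 (1 - α), 0 < derivWithin c (Icc 0 (1 - α)) e
  deriv_two_pos : ∀ e ∈ Ioc 0 (1 - α), 0 < iteratedDerivWithin 2 c (Icc 0 (1 - α)) e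
  deriv_three_nonneg : ∀ e ∈ Icc 0 (1 - α), 0 ≤ iteratedDerivWithin 3 c (Icc 0 (1 - α)) e
  deriv_zero : derivWithin c (Icc 0 (1 - α)) 0 = 0
  one_lt_deriv : 1 < derivWithin c (Icc 0 (1 - α)) (1 - α)

/-- A grading rule `(g⁰, g¹)`: `g0` and `g1` are the probabilities of the grade "pass" for
students with productive value `0` and `1` respectively. -/
@[ext]
structure GradingRule (b : ℝ) where
  g0 : ℝ
  g1 : ℝ
  g0_mem : g0 ∈ Icc (0 : ℝ) 1
  g1_mem : g1 ∈ Icc (0 : ℝ) 1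
  lt : g0 < g1
  sub_le : g1 - g0 ≤ b

namespace GradingRule

/-- The lenient rule `G_⋆ = (1 - b, 1)`. -/
def lenient (b : ℝ) (hb : b ∈ Ioo (0 : ℝ) 1) : GradingRule b where
  g0 := 1 - b
  g1 := 1
  g0_mem := ⟨by linarith [hb.2], by linarith [hb.1]⟩
  g1_mem := ⟨zero_le_one, le_rfl⟩
  lt := by linarith [hb.1]
  sub_le := by linarith

/-- The tough rule `G^⋆ = (0, b)`. -/
def tough (b : ℝ) (hb : b ∈ Ioo (0 : ℝ) 1) : GradingRule b where
  g0 := 0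
  g1 := b
  g0_mem := ⟨le_rfl, zero_le_one⟩
  g1_mem := ⟨hb.1.le, hb.2.le⟩
  lt := hb.1
  sub_le := by linarith

variable {b : ℝ}

/-- Probability of the grade "pass" when productive value is `1` with probability `x`. -/
def passProb (G : GradingRule b) (x : ℝ) : ℝ :=
  x * G.g1 + (1 - x) * G.g0

/-- Employers' posterior belief that productive value is `1` after the grade "pass", if their
prior belief is `x`. -/
def posteriorPass (G : GradingRule b) (x : ℝ) : ℝ :=
  x * G.g1 / (x * G.g1 + (1 - x) * G.g0)

/-- Employers' posterior belief that productive value is `1` after the grade "fail", if their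
prior belief is `x`. -/
def posteriorFail (G : GradingRule b) (x : ℝ) : ℝ :=
  x * (1 - G.g1) / (x * (1 - G.g1) + (1 - x) * (1 - G.g0))

end GradingRule

/-- A school system for a continuum of students with types in `(0, α)` distributed according
to `F`: a number of schools, a measurable assignment of types to schools under which every
school has positive mass, and a grading rule for every school. -/
structure SchoolSystem (α b : ℝ) (F : Measure ℝ) where
  n : ℕ
  φ : Ioo (0 : ℝ) α → Fin n
  measurable_φ : Measurable φ
  G : Fin n → GradingRule b
  mass_pos : ∀ s, 0 < F (Subtype.val '' (φ ⁻¹' {s}))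

namespace SchoolSystem

variable {α b : ℝ} {F : Measure ℝ}

/-- The set of types of the students attending school `s`. -/
def students (σ : SchoolSystem α b F) (s : Fin σ.n) : Set ℝ :=
  Subtype.val '' (σ.φ ⁻¹' {s})

/-- The mass `m_s` of students attending school `s`. -/
def mass (σ : SchoolSystem α b F) (s : Fin σ.n) : ℝ :=
  F.real (σ.students s)

/-- The average type of the students attending school `s`. -/
def avgType (σ : SchoolSystem α b F) (s : Fin σ.n) : ℝ :=
  (∫ θ in σ.students s, θ ∂F) / σ.mass s

/-- The expected payoff `U_s(θ, e, ê)` of a type-`θ` student of school `s` who exerts effort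
`e` when employers conjecture that the students of `s` exert effort `ê`: expected wage minus
cost of effort, wages being equal to posterior beliefs. -/
def payoff (c : ℝ → ℝ) (σ : SchoolSystem α b F) (s : Fin σ.n) (θ e ehat : ℝ) : ℝ :=
  (σ.G s).passProb (θ + e) * (σ.G s).posteriorPass (σ.avgType s + ehat)
    + (1 - (σ.G s).passProb (θ + e)) * (σ.G s).posteriorFail (σ.avgType s + ehat)
    - c e

/-- `e` is an equilibrium effort in school `s` if it maximizes, over the feasible efforts
`[0, 1 - α]`, the expected payoff of the students of `s` given the conjecture `e`. -/
def IsEquilibriumEffort (c : ℝ → ℝ) (σ : SchoolSystem α b F) (s : Fin σ.n) (e : ℝ) : Prop :=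
  e ∈ Icc 0 (1 - α) ∧
    ∀ θ ∈ σ.students s, ∀ e' ∈ Icc 0 (1 - α), σ.payoff c s θ e' e ≤ σ.payoff c s θ e e

/-- The equilibrium effort of school `s`
(it exists and is unique for a cost function, `0 < α < 1` and `0 < b < 1`). -/
def effort (c : ℝ → ℝ) (σ : SchoolSystem α b F) (s : Fin σ.n) : ℝ :=
  Classical.epsilon (σ.IsEquilibriumEffort c s)

/-- The maximum expected payoff `U*_s(θ)` of a type-`θ` student from attending school `s`. -/
def value (c : ℝ → ℝ) (σ : SchoolSystem α b F) (s : Fin σ.n) (θ : ℝ) : ℝ :=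
  σ.payoff c s θ (σ.effort c s) (σ.effort c s)

/-- Social welfare. -/
def welfare (c : ℝ → ℝ) (σ : SchoolSystem α b F) : ℝ :=
  ∑ s, σ.mass s * (σ.avgType s + σ.effort c s - c (σ.effort c s))

/-- Incentive compatibility with transfers: for some school fees `t`, every type weakly prefers
the school to which it is assigned. -/
def IncentiveCompatible (c : ℝ → ℝ) (σ : SchoolSystem α b F) : Prop :=
  ∃ t : Fin σ.n → ℝ, ∀ (θ : Ioo (0 : ℝ) α) (s : Fin σ.n),
    σ.value c s θ - t s ≤ σ.value c (σ.φ θ) θ - t (σ.φ θ)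

/-- Welfare maximality among the incentive compatible school systems. -/
def ConstrainedOptimal (c : ℝ → ℝ) (σ : SchoolSystem α b F) : Prop :=
  σ.IncentiveCompatible c ∧
    ∀ σ' : SchoolSystem α b F, σ'.IncentiveCompatible c → σ'.welfare c ≤ σ.welfare c

/-- Single-tier structure: all schools have the same average type. -/
def IsSingleTier (σ : SchoolSystem α b F) : Prop :=
  ∀ s s' : Fin σ.n, σ.avgType s = σ.avgType s'

/-- The non-empty sets `S` (bottom tier) and `T` (top tier) partition the schools into two
tiers: the average type is constant on each tier and lower in `S` than in `T`, and, up to a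
null set of students, the types in `T` are at least as large as the types in `S`. -/
structure IsTwoTierWith (σ : SchoolSystem α b F) (S T : Set (Fin σ.n)) : Prop where
  bottom_nonempty : S.Nonempty
  top_nonempty : T.Nonempty
  disjoint : Disjoint S T
  union_eq : S ∪ T = univ
  bottom_avg : ∀ s ∈ S, ∀ s' ∈ S, σ.avgType s = σ.avgType s'
  top_avg : ∀ s ∈ T, ∀ s' ∈ T, σ.avgType s = σ.avgType s'
  avg_lt : ∀ s ∈ S, ∀ s' ∈ T, σ.avgType s < σ.avgType s'
  sorted : ∃ N : Set ℝ, F N = 0 ∧ ∀ θ θ' : Ioo (0 : ℝ) α, (θ : ℝ) ∉ N → (θ' : ℝ) ∉ N →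
    σ.φ θ ∈ S → σ.φ θ' ∈ T → θ ≤ θ'

/-- Two-tier structure. -/
def IsTwoTier (σ : SchoolSystem α b F) : Prop :=
  ∃ S T : Set (Fin σ.n), σ.IsTwoTierWith S T

end SchoolSystem

end

/-!
# Constrained-optimal school systems have at most two tiers

The equilibrium effort `e` of a school with average type `a` and grading rule `G` solves
`c' e = D (a + e)`, where `D x = (g¹ - g⁰) (q⁺ x - q⁻ x)` is the marginal return to effort at
prior `x`. Among all rules, `D x` is maximal for the lenient rule if `x ≥ 1 / 2` and for the tough
rule if `x ≤ 1 / 2`, and for no other rule if the inequality is strict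
(`GradingRule.lenientReturn_sub`, `GradingRule.toughReturn_sub`). For these two rules `D` is
strictly concave in `x`; as `c'` is convex and effort stays below its first-best level, the surplus
`e - c e` is a strictly concave function of the average type
(`IsConcaveReturn.strictConcaveOn_inducedSurplus`), increasing under the lenient rule and
decreasing under the tough one.

Equilibrium payoffs are affine in the type with slope `c' e`, so incentive compatibility means that
higher types attend schools with higher effort. Call a school tough or lenient according to which
of the two rules induces more effort at its average type. If all schools are of one kind, then by
Jensen's inequality pooling everyone under the corresponding rule is a strict improvement unless
the average types coincide. Otherwise the tough schools have the lower average types, hence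
efforts that are no larger. Compare the system with the cutoff system that has as many students below the cutoff
as there are in tough schools, with lenient grading above the cutoff and, below it, tough grading
or, if that would induce more effort than there is above, a rule that induces the same effort as
above. Jensen's inequality within each kind and rearrangement of the types (which lowers the mean
of the bottom and raises the mean of the top) show that the cutoff system is at least as good, with
equality only for a sorted system whose averages are constant on each kind and whose efforts are
the largest possible (`SchoolSystem.ConstrainedOptimal.exists_isSortedAt`). The case in which effort
below the cutoff is held down is never optimal, because raising the cutoff then raises everyone's
effort (`SchoolSystem.ConstrainedOptimal.lenientSurplus_lt`). Maximal effort at a prior on the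
strict side of `1 / 2` finally identifies the grading rules.
-/

noncomputable section

/-! ### Cost functions -/

/-- Marginal cost of effort `c'`, one-sided at the endpoints of `[0, 1 - α]`. -/
def marginalCost (α : ℝ) (c : ℝ → ℝ) : ℝ → ℝ :=
  derivWithin c (Icc 0 (1 - α))

namespace IsCostFunction

variable {α : ℝ} {c : ℝ → ℝ}

lemma differentiableOn (hc : IsCostFunction α c) : DifferentiableOn ℝ c (Icc 0 (1 - α)) := by
  simpa using hc.diff 0 (by norm_num)

lemma differentiableOn_marginalCost (hc : IsCostFunction α c) :
    DifferentiableOn ℝ (marginalCost α c) (Icc 0 (1 - α)) := by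
  have h := hc.diff 1 (by norm_num)
  rwa [iteratedDerivWithin_one] at h

lemma deriv_marginalCost {e : ℝ} (he : e ∈ Ioo 0 (1 - α)) :
    deriv (marginalCost α c) e = iteratedDerivWithin 2 c (Icc 0 (1 - α)) e := by
  rw [iteratedDerivWithin_succ, derivWithin_of_mem_nhds (Icc_mem_nhds he.1 he.2)]
  rw [iteratedDerivWithin_one, marginalCost]

lemma strictMonoOn_marginalCost (hc : IsCostFunction α c) :
    StrictMonoOn (marginalCost α c) (Icc 0 (1 - α)) := by
  refine strictMonoOn_of_deriv_pos (convex_Icc _ _)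
    hc.differentiableOn_marginalCost.continuousOn fun e he => ?_
  rw [interior_Icc] at he
  rw [deriv_marginalCost he]
  exact hc.deriv_two_pos e ⟨he.1, he.2.le⟩

/-- Marginal cost is convex because the third derivative of the cost is non-negative. -/
lemma convexOn_marginalCost (hc : IsCostFunction α c) :
    ConvexOn ℝ (Icc 0 (1 - α)) (marginalCost α c) := by
  have hmono : MonotoneOn (iteratedDerivWithin 2 c (Icc 0 (1 - α))) (Icc 0 (1 - α)) := by
    have hd := hc.diff 2 (by norm_num)
    refine monotoneOn_of_deriv_nonneg (convex_Icc _ _) hd.continuousOn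
      (hd.mono interior_subset) fun e he => ?_
    rw [interior_Icc] at he
    have h := hc.deriv_three_nonneg e (Ioo_subset_Icc_self he)
    rwa [iteratedDerivWithin_succ, derivWithin_of_mem_nhds (Icc_mem_nhds he.1 he.2)] at h
  refine MonotoneOn.convexOn_of_deriv (convex_Icc _ _)
    hc.differentiableOn_marginalCost.continuousOn
    (hc.differentiableOn_marginalCost.mono interior_subset) ?_
  rw [interior_Icc]
  intro x hx y hy hxy
  rw [deriv_marginalCost hx, deriv_marginalCost hy]
  exact hmono (Ioo_subset_Icc_self hx) (Ioo_subset_Icc_self hy) hxy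

lemma exists_slope_eq (hc : IsCostFunction α c) {e e' : ℝ} (he : 0 ≤ e) (he' : e' ≤ 1 - α)
    (h : e < e') : ∃ ξ ∈ Ioo e e', c e' - c e = marginalCost α c ξ * (e' - e) := by
  have hsub : Icc e e' ⊆ Icc 0 (1 - α) := Icc_subset_Icc he he'
  obtain ⟨ξ, hξ, h1⟩ := exists_deriv_eq_slope c h (hc.differentiableOn.continuousOn.mono hsub)
    (hc.differentiableOn.mono (Ioo_subset_Icc_self.trans hsub))
  refine ⟨ξ, hξ, ?_⟩
  have h2 : marginalCost α c ξ = deriv c ξ :=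
    derivWithin_of_mem_nhds (Icc_mem_nhds (he.trans_lt hξ.1) (hξ.2.trans_le he'))
  rw [h2, h1, div_mul_cancel₀ _ (sub_pos.2 h).ne']

lemma tangent_lt (hc : IsCostFunction α c) {e e' : ℝ} (he : e ∈ Icc 0 (1 - α))
    (he' : e' ∈ Icc 0 (1 - α)) (h : e' ≠ e) :
    c e + marginalCost α c e * (e' - e) < c e' := by
  rcases lt_or_gt_of_ne h with h | h
  · obtain ⟨ξ, hξ, h1⟩ := hc.exists_slope_eq he'.1 he.2 h
    have := hc.strictMonoOn_marginalCost
      (⟨he'.1.trans hξ.1.le, hξ.2.le.trans he.2⟩ : ξ ∈ Icc 0 (1 - α)) he hξ.2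
    nlinarith
  · obtain ⟨ξ, hξ, h1⟩ := hc.exists_slope_eq he.1 he'.2 h
    have := hc.strictMonoOn_marginalCost he
      (⟨he.1.trans hξ.1.le, hξ.2.le.trans he'.2⟩ : ξ ∈ Icc 0 (1 - α)) hξ.1
    nlinarith

lemma marginalCost_zero (hc : IsCostFunction α c) : marginalCost α c 0 = 0 := hc.deriv_zero

/-- Below the first-best effort, at which marginal cost is `1`, surplus `e - c e` is strictly
increasing in effort. -/
lemma surplus_lt (hc : IsCostFunction α c) {e e' : ℝ} (he : 0 ≤ e) (he' : e' ≤ 1 - α)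
    (h : e < e') (h1 : marginalCost α c e' ≤ 1) : e - c e < e' - c e' := by
  have := hc.tangent_lt (e := e') (e' := e) ⟨he.trans h.le, he'⟩ ⟨he, h.le.trans he'⟩ h.ne
  nlinarith

lemma surplus_le (hc : IsCostFunction α c) {e e' : ℝ} (he : 0 ≤ e) (he' : e' ≤ 1 - α)
    (h : e ≤ e') (h1 : marginalCost α c e' ≤ 1) : e - c e ≤ e' - c e' := by
  rcases h.eq_or_lt with rfl | h
  · rfl
  · exact (hc.surplus_lt he he' h h1).le

lemma concaveOn_surplus (hc : IsCostFunction α c) :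
    ConcaveOn ℝ (Icc 0 (1 - α)) fun e => e - c e := by
  refine (concaveOn_id (convex_Icc _ _)).sub ⟨convex_Icc _ _, fun x hx y hy p q hp hq hpq => ?_⟩
  have hz : p • x + q • y ∈ Icc 0 (1 - α) := convex_Icc _ _ hx hy hp hq hpq
  -- the tangent at the intermediate point lies below the graph at both endpoints
  have key : ∀ u ∈ Icc 0 (1 - α), c (p • x + q • y) +
      marginalCost α c (p • x + q • y) * (u - (p • x + q • y)) ≤ c u := fun u hu => by
    by_cases h : u = p • x + q • y
    · rw [← h]; simp
    · exact (hc.tangent_lt hz hu h).le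
  have h1 := mul_le_mul_of_nonneg_left (key x hx) hp
  have h2 := mul_le_mul_of_nonneg_left (key y hy) hq
  simp only [smul_eq_mul] at *
  generalize c (p * x + q * y) = C at *
  generalize marginalCost α c (p * x + q * y) = K at *
  obtain rfl : q = 1 - p := by linarith
  nlinarith

/-- When marginal returns to effort along a line `a + e` are positive and at most `1`, they
equal marginal cost at some interior effort. -/
lemma exists_marginalCost_eq (hc : IsCostFunction α c) (hα : α ∈ Ioo (0 : ℝ) 1) {M : ℝ → ℝ}
    (hM : ContinuousOn M (Ioo 0 1)) (hM0 : ∀ x ∈ Ioo (0 : ℝ) 1, 0 < M x)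
    (hM1 : ∀ x ∈ Ioo (0 : ℝ) 1, M x ≤ 1) {a : ℝ} (ha : a ∈ Ioo 0 α) :
    ∃ e ∈ Ioo 0 (1 - α), marginalCost α c e = M (a + e) := by
  have hR : 0 ≤ 1 - α := by linarith [hα.2]
  have hmaps : MapsTo (fun e => a + e) (Icc 0 (1 - α)) (Ioo 0 1) := fun e he =>
    ⟨by linarith [ha.1, he.1], by linarith [ha.2, he.2]⟩
  have hcont : ContinuousOn (fun e => marginalCost α c e - M (a + e)) (Icc 0 (1 - α)) :=
    hc.differentiableOn_marginalCost.continuousOn.sub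
      (hM.comp (by fun_prop) hmaps)
  have h0 : (0 : ℝ) ∈ Ioo ((fun e => marginalCost α c e - M (a + e)) 0)
      ((fun e => marginalCost α c e - M (a + e)) (1 - α)) := by
    have h1 := hM0 _ (hmaps (left_mem_Icc.2 hR))
    have h2 := hM1 _ (hmaps (right_mem_Icc.2 hR))
    have h3 : 1 < marginalCost α c (1 - α) := hc.one_lt_deriv
    have h4 := hc.marginalCost_zero
    simp only at h1 h2
    constructor <;> simp only <;> linarith
  obtain ⟨e, he, h⟩ := intermediate_value_Ioo hR hcont h0
  exact ⟨e, he, by simpa [sub_eq_zero] using h⟩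

end IsCostFunction

/-! ### Returns to effort under a grading rule -/

/-- Marginal return to effort under the lenient rule, as a function of the employers' prior. -/
def lenientReturn (b x : ℝ) : ℝ := b * x / (1 - b + b * x)

/-- Marginal return to effort under the tough rule, as a function of the employers' prior. -/
def toughReturn (b x : ℝ) : ℝ := lenientReturn b (1 - x)

section Returns

variable {b : ℝ}

lemma lenientReturn_eq (hb : b ∈ Ioo (0 : ℝ) 1) {x : ℝ} (hx : 0 < x) :
    lenientReturn b x = 1 - (1 - b) * (1 - b + b * x)⁻¹ := by
  have : 0 < 1 - b + b * x := by nlinarith [hb.1, hb.2, mul_pos hb.1 hx]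
  unfold lenientReturn
  field_simp
  ring

lemma lenientReturn_pos (hb : b ∈ Ioo (0 : ℝ) 1) {x : ℝ} (hx : 0 < x) :
    0 < lenientReturn b x :=
  div_pos (mul_pos hb.1 hx) (by linarith [hb.2, mul_pos hb.1 hx])

lemma lenientReturn_lt_one (hb : b ∈ Ioo (0 : ℝ) 1) {x : ℝ} (hx : 0 < x) :
    lenientReturn b x < 1 := by
  have := mul_pos hb.1 hx
  unfold lenientReturn
  rw [div_lt_one (by linarith [hb.2])]
  linarith [hb.2]

lemma lenientReturn_lt_iff (hb : b ∈ Ioo (0 : ℝ) 1) {x y : ℝ} (hx : 0 < x) (hy : 0 < y) :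
    lenientReturn b x < lenientReturn b y ↔ x < y := by
  have hbx := mul_pos hb.1 hx
  have hby := mul_pos hb.1 hy
  unfold lenientReturn
  rw [div_lt_div_iff₀ (by linarith [hb.2]) (by linarith [hb.2])]
  have h : b * y * (1 - b + b * x) - b * x * (1 - b + b * y) = b * (1 - b) * (y - x) := by ring
  have hbb : 0 < b * (1 - b) := mul_pos hb.1 (by linarith [hb.2])
  constructor
  · intro h1
    have : 0 < b * (1 - b) * (y - x) := by linarith
    linarith [pos_of_mul_pos_right this hbb.le]
  · intro h1
    have : 0 < b * (1 - b) * (y - x) := mul_pos hbb (by linarith)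
    linarith

lemma continuousOn_lenientReturn (hb : b ∈ Ioo (0 : ℝ) 1) :
    ContinuousOn (lenientReturn b) (Ioi 0) := by
  refine ContinuousOn.div (by fun_prop) (by fun_prop) fun x hx => ?_
  have := mul_pos hb.1 (mem_Ioi.1 hx)
  linarith [hb.2]

lemma strictConcaveOn_lenientReturn (hb : b ∈ Ioo (0 : ℝ) 1) :
    StrictConcaveOn ℝ (Ioi 0) (lenientReturn b) := by
  refine ⟨convex_Ioi _, fun x hx y hy hxy p q hp hq hpq => ?_⟩
  rw [mem_Ioi] at hx hy
  simp only [smul_eq_mul]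
  have hbx := mul_pos hb.1 hx
  have hby := mul_pos hb.1 hy
  have hz : 0 < p * x + q * y := add_pos (mul_pos hp hx) (mul_pos hq hy)
  rw [lenientReturn_eq hb hx, lenientReturn_eq hb hy, lenientReturn_eq hb hz]
  obtain rfl : q = 1 - p := by linarith
  set u := 1 - b + b * x with hu
  set v := 1 - b + b * y with hv
  have hu0 : 0 < u := by linarith [hb.2]
  have hv0 : 0 < v := by linarith [hb.2]
  have huv : u - v ≠ 0 := by
    rw [hu, hv, show 1 - b + b * x - (1 - b + b * y) = b * (x - y) by ring]
    exact mul_ne_zero hb.1.ne' (sub_ne_zero.2 hxy)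
  have hw : 1 - b + b * (p * x + (1 - p) * y) = p * u + (1 - p) * v := by rw [hu, hv]; ring
  have hw0 : 0 < p * u + (1 - p) * v := add_pos (mul_pos hp hu0) (mul_pos hq hv0)
  rw [hw]
  have key : (p * u + (1 - p) * v)⁻¹ < p * u⁻¹ + (1 - p) * v⁻¹ := by
    have : p * u⁻¹ + (1 - p) * v⁻¹ - (p * u + (1 - p) * v)⁻¹
        = p * (1 - p) * (u - v) ^ 2 / (u * v * (p * u + (1 - p) * v)) := by
      field_simp
      ring
    have h2 : 0 < p * (1 - p) * (u - v) ^ 2 / (u * v * (p * u + (1 - p) * v)) := by positivity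
    linarith
  nlinarith [mul_lt_mul_of_pos_left key (show 0 < 1 - b by linarith [hb.2])]

end Returns

namespace GradingRule

variable {b : ℝ} (G : GradingRule b)

/-- Marginal return to effort, i.e. the increase in the expected wage per unit of effort, when
the employers' prior is `x`. -/
def marginalReturn (x : ℝ) : ℝ :=
  (G.g1 - G.g0) * (G.posteriorPass x - G.posteriorFail x)

lemma passProb_pos {x : ℝ} (hx : x ∈ Ioo (0 : ℝ) 1) : 0 < G.passProb x := by
  have h1 : 0 < G.g1 := G.g0_mem.1.trans_lt G.lt
  have := mul_pos hx.1 h1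
  have := mul_nonneg (sub_pos.2 hx.2).le G.g0_mem.1
  unfold passProb
  linarith

lemma passProb_lt_one {x : ℝ} (hx : x ∈ Ioo (0 : ℝ) 1) : G.passProb x < 1 := by
  have h0 : 0 < 1 - G.g0 := by linarith [G.lt, G.g1_mem.2]
  have := mul_pos (sub_pos.2 hx.2) h0
  have := mul_nonneg hx.1.le (sub_nonneg.2 G.g1_mem.2)
  unfold passProb
  linarith

lemma marginalReturn_eq {x : ℝ} (hx : x ∈ Ioo (0 : ℝ) 1) :
    G.marginalReturn x =
      (G.g1 - G.g0) ^ 2 * x * (1 - x) / (G.passProb x * (1 - G.passProb x)) := by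
  have h1 := G.passProb_pos hx
  have h2 : 0 < 1 - G.passProb x := by linarith [G.passProb_lt_one hx]
  have h3 : x * (1 - G.g1) + (1 - x) * (1 - G.g0) = 1 - G.passProb x := by
    unfold passProb; ring
  have h4 : x * G.g1 + (1 - x) * G.g0 = G.passProb x := rfl
  unfold marginalReturn posteriorPass posteriorFail
  rw [h3, h4, div_sub_div _ _ h1.ne' h2.ne', ← mul_div_assoc]
  congr 1
  unfold passProb
  ring

lemma marginalReturn_pos {x : ℝ} (hx : x ∈ Ioo (0 : ℝ) 1) : 0 < G.marginalReturn x := by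
  rw [G.marginalReturn_eq hx]
  have h1 := G.passProb_pos hx
  have h2 : 0 < 1 - G.passProb x := by linarith [G.passProb_lt_one hx]
  have h3 := sub_pos.2 G.lt
  have h4 := hx.1
  have h5 := sub_pos.2 hx.2
  positivity

lemma continuousOn_marginalReturn : ContinuousOn G.marginalReturn (Ioo 0 1) := by
  unfold marginalReturn posteriorPass posteriorFail
  refine continuousOn_const.mul (ContinuousOn.sub ?_ ?_)
  · exact ContinuousOn.div (by fun_prop) (by fun_prop) fun x hx => (G.passProb_pos hx).ne'
  · refine ContinuousOn.div (by fun_prop) (by fun_prop) fun x hx => ?_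
    have := G.passProb_lt_one hx
    unfold passProb at this
    nlinarith

/-- Bayes plausibility: wages average to the prior, so a student's expected wage departs from
the prior only in proportion to the deviation of their own success probability from it. -/
lemma expected_wage {x : ℝ} (hx : x ∈ Ioo (0 : ℝ) 1) (y : ℝ) :
    G.passProb y * G.posteriorPass x + (1 - G.passProb y) * G.posteriorFail x
      = x + G.marginalReturn x * (y - x) := by
  have h1 := G.passProb_pos hx
  have h2 : 0 < 1 - G.passProb x := by linarith [G.passProb_lt_one hx]
  have h3 : x * (1 - G.g1) + (1 - x) * (1 - G.g0) = 1 - G.passProb x := by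
    unfold passProb; ring
  have hp : G.passProb x * G.posteriorPass x = x * G.g1 := mul_div_cancel₀ _ h1.ne'
  have hf : (1 - G.passProb x) * G.posteriorFail x = x * (1 - G.g1) := by
    unfold posteriorFail
    rw [h3]
    exact mul_div_cancel₀ _ h2.ne'
  have hy : G.passProb y = G.passProb x + (G.g1 - G.g0) * (y - x) := by unfold passProb; ring
  rw [hy]
  unfold marginalReturn
  linear_combination hp + hf

/-- The shortfall of the return under `G` from the return under the lenient rule, as a sum of
terms that are non-negative when the prior is at least `1 / 2`. -/
lemma lenientReturn_sub (hb : b ∈ Ioo (0 : ℝ) 1) {x : ℝ} (hx : x ∈ Ioo (0 : ℝ) 1) :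
    lenientReturn b x - G.marginalReturn x =
      x * (b * (G.g1 * (1 - G.g1)) * (2 * x - 1)
        + (1 - x) * (2 * b * (G.g0 * (1 - G.g1)) + (G.g1 - G.g0) * (b - (G.g1 - G.g0))))
      / ((1 - b + b * x) * (G.passProb x * (1 - G.passProb x))) := by
  have h1 := G.passProb_pos hx
  have h2 : 0 < 1 - G.passProb x := by linarith [G.passProb_lt_one hx]
  have h3 : 0 < 1 - b + b * x := by linarith [hb.2, mul_pos hb.1 hx.1]
  rw [G.marginalReturn_eq hx, lenientReturn, div_sub_div _ _ h3.ne' (mul_pos h1 h2).ne']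
  congr 1
  unfold passProb
  ring

/-- The analogue of `lenientReturn_sub` for the tough rule. -/
lemma toughReturn_sub (hb : b ∈ Ioo (0 : ℝ) 1) {x : ℝ} (hx : x ∈ Ioo (0 : ℝ) 1) :
    toughReturn b x - G.marginalReturn x =
      (1 - x) * (b * (G.g0 * (1 - G.g0)) * (1 - 2 * x)
        + x * (2 * b * (G.g0 * (1 - G.g1)) + (G.g1 - G.g0) * (b - (G.g1 - G.g0))))
      / ((1 - b + b * (1 - x)) * (G.passProb x * (1 - G.passProb x))) := by
  have h1 := G.passProb_pos hx
  have h2 : 0 < 1 - G.passProb x := by linarith [G.passProb_lt_one hx]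
  have h3 : 0 < 1 - b + b * (1 - x) := by
    linarith [hb.2, mul_pos hb.1 (sub_pos.2 hx.2)]
  rw [G.marginalReturn_eq hx, toughReturn, lenientReturn,
    div_sub_div _ _ h3.ne' (mul_pos h1 h2).ne']
  congr 1
  unfold passProb
  ring

lemma marginalReturn_le_lenient (hb : b ∈ Ioo (0 : ℝ) 1) {x : ℝ} (hx : x ∈ Ioo (0 : ℝ) 1)
    (hx2 : 1 / 2 ≤ x) : G.marginalReturn x ≤ lenientReturn b x := by
  have h1 := G.passProb_pos hx
  have h2 : 0 < 1 - G.passProb x := by linarith [G.passProb_lt_one hx]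
  have h3 : 0 < 1 - b + b * x := by linarith [hb.2, mul_pos hb.1 hx.1]
  rw [← sub_nonneg, G.lenientReturn_sub hb hx]
  have := hb.1
  have := hx.1
  have := sub_pos.2 hx.2
  have := G.g0_mem.1
  have := G.g1_mem.1
  have := sub_nonneg.2 G.g1_mem.2
  have := sub_pos.2 G.lt
  have := sub_nonneg.2 G.sub_le
  have : 0 ≤ 2 * x - 1 := by linarith
  positivity

lemma marginalReturn_le_tough (hb : b ∈ Ioo (0 : ℝ) 1) {x : ℝ} (hx : x ∈ Ioo (0 : ℝ) 1)
    (hx2 : x ≤ 1 / 2) : G.marginalReturn x ≤ toughReturn b x := by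
  have h1 := G.passProb_pos hx
  have h2 : 0 < 1 - G.passProb x := by linarith [G.passProb_lt_one hx]
  have h3 : 0 < 1 - b + b * (1 - x) := by
    linarith [hb.2, mul_pos hb.1 (sub_pos.2 hx.2)]
  rw [← sub_nonneg, G.toughReturn_sub hb hx]
  have := hb.1
  have := hx.1
  have := sub_pos.2 hx.2
  have := G.g0_mem.1
  have : 0 ≤ 1 - G.g0 := sub_nonneg.2 G.g0_mem.2
  have := sub_nonneg.2 G.g1_mem.2
  have := sub_pos.2 G.lt
  have := sub_nonneg.2 G.sub_le
  have : 0 ≤ 1 - 2 * x := by linarith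
  positivity

lemma marginalReturn_lt_one (hb : b ∈ Ioo (0 : ℝ) 1) {x : ℝ} (hx : x ∈ Ioo (0 : ℝ) 1) :
    G.marginalReturn x < 1 := by
  rcases le_total (1 / 2) x with h | h
  · exact (G.marginalReturn_le_lenient hb hx h).trans_lt (lenientReturn_lt_one hb hx.1)
  · exact (G.marginalReturn_le_tough hb hx h).trans_lt
      (lenientReturn_lt_one hb (sub_pos.2 hx.2))

lemma eq_lenient_of_marginalReturn_eq (hb : b ∈ Ioo (0 : ℝ) 1) {x : ℝ}
    (hx : x ∈ Ioo (0 : ℝ) 1) (hx2 : 1 / 2 < x)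
    (h : G.marginalReturn x = lenientReturn b x) : G = lenient b hb := by
  have h1 := G.passProb_pos hx
  have h2 : 0 < 1 - G.passProb x := by linarith [G.passProb_lt_one hx]
  have h3 : 0 < 1 - b + b * x := by linarith [hb.2, mul_pos hb.1 hx.1]
  have key := G.lenientReturn_sub hb hx
  have hb0 := hb.1
  have hg0 := G.g0_mem.1
  have hg1 : 0 < G.g1 := G.g0_mem.1.trans_lt G.lt
  have hg1' := sub_nonneg.2 G.g1_mem.2
  have hd := sub_pos.2 G.lt
  have hd' := sub_nonneg.2 G.sub_le
  have hx3 : 0 < 2 * x - 1 := by linarith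
  have hx4 := sub_pos.2 hx.2
  rw [h, sub_self, eq_comm, div_eq_zero_iff, or_iff_left (by positivity), mul_eq_zero,
    or_iff_right hx.1.ne', add_eq_zero_iff_of_nonneg (by positivity) (by positivity)] at key
  obtain ⟨k1, k2⟩ := key
  have e1 : G.g1 = 1 := by
    have : 1 - G.g1 = 0 := by simpa [hb0.ne', hg1.ne', hx3.ne'] using k1
    linarith
  rw [e1] at k2
  have e2 : b - (1 - G.g0) = 0 := by
    have : 1 - G.g0 ≠ 0 := by rw [← e1]; exact hd.ne'
    simpa [hx4.ne', this] using k2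
  ext
  · simp only [lenient]; linarith
  · exact e1

lemma eq_tough_of_marginalReturn_eq (hb : b ∈ Ioo (0 : ℝ) 1) {x : ℝ}
    (hx : x ∈ Ioo (0 : ℝ) 1) (hx2 : x < 1 / 2)
    (h : G.marginalReturn x = toughReturn b x) : G = tough b hb := by
  have h1 := G.passProb_pos hx
  have h2 : 0 < 1 - G.passProb x := by linarith [G.passProb_lt_one hx]
  have h3 : 0 < 1 - b + b * (1 - x) := by
    linarith [hb.2, mul_pos hb.1 (sub_pos.2 hx.2)]
  have key := G.toughReturn_sub hb hx
  have hb0 := hb.1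
  have hg0 := G.g0_mem.1
  have hg0' : 0 < 1 - G.g0 := by linarith [G.lt, G.g1_mem.2]
  have hg1' := sub_nonneg.2 G.g1_mem.2
  have hd := sub_pos.2 G.lt
  have hd' := sub_nonneg.2 G.sub_le
  have hx3 : 0 < 1 - 2 * x := by linarith
  have hx4 := sub_pos.2 hx.2
  have hx5 := hx.1
  rw [h, sub_self, eq_comm, div_eq_zero_iff, or_iff_left (by positivity), mul_eq_zero,
    or_iff_right hx4.ne', add_eq_zero_iff_of_nonneg (by positivity) (by positivity)] at key
  obtain ⟨k1, k2⟩ := key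
  have e1 : G.g0 = 0 := by simpa [hb0.ne', hg0'.ne', hx3.ne'] using k1
  rw [e1] at k2 hd
  have e2 : b - G.g1 = 0 := by
    have : G.g1 ≠ 0 := by simpa using hd.ne'
    simpa [hx5.ne', this] using k2
  ext
  · exact e1
  · simp only [tough]; linarith

lemma marginalReturn_lenient (hb : b ∈ Ioo (0 : ℝ) 1) {x : ℝ} (hx : x ∈ Ioo (0 : ℝ) 1) :
    (lenient b hb).marginalReturn x = lenientReturn b x := by
  have := (lenient b hb).lenientReturn_sub hb hx
  rw [eq_comm, ← sub_eq_zero, this]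
  simp [lenient]

lemma marginalReturn_tough (hb : b ∈ Ioo (0 : ℝ) 1) {x : ℝ} (hx : x ∈ Ioo (0 : ℝ) 1) :
    (tough b hb).marginalReturn x = toughReturn b x := by
  have := (tough b hb).toughReturn_sub hb hx
  rw [eq_comm, ← sub_eq_zero, this]
  simp [tough]

end GradingRule

/-! ### Equilibrium effort as a function of the average type -/

/-- The properties of a marginal return to effort, as a function of the employers' prior, that
make the effort it induces unique and strictly concave in the average type. -/
structure IsConcaveReturn (M : ℝ → ℝ) : Prop where
  continuousOn : ContinuousOn M (Ioo 0 1)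
  pos : ∀ x ∈ Ioo (0 : ℝ) 1, 0 < M x
  lt_one : ∀ x ∈ Ioo (0 : ℝ) 1, M x < 1
  strictConcaveOn : StrictConcaveOn ℝ (Ioo 0 1) M

lemma isConcaveReturn_lenient {b : ℝ} (hb : b ∈ Ioo (0 : ℝ) 1) :
    IsConcaveReturn (lenientReturn b) where
  continuousOn := (continuousOn_lenientReturn hb).mono Ioo_subset_Ioi_self
  pos _ hx := lenientReturn_pos hb hx.1
  lt_one _ hx := lenientReturn_lt_one hb hx.1
  strictConcaveOn := (strictConcaveOn_lenientReturn hb).subset Ioo_subset_Ioi_self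
    (convex_Ioo _ _)

lemma isConcaveReturn_tough {b : ℝ} (hb : b ∈ Ioo (0 : ℝ) 1) :
    IsConcaveReturn (toughReturn b) where
  continuousOn := (continuousOn_lenientReturn hb).comp (by fun_prop)
    fun _ hx => sub_pos.2 hx.2
  pos _ hx := lenientReturn_pos hb (sub_pos.2 hx.2)
  lt_one _ hx := lenientReturn_lt_one hb (sub_pos.2 hx.2)
  strictConcaveOn := by
    refine ⟨convex_Ioo _ _, fun x hx y hy hxy p q hp hq hpq => ?_⟩
    have h := (strictConcaveOn_lenientReturn hb).2 (x := 1 - x) (y := 1 - y)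
      (sub_pos.2 hx.2) (sub_pos.2 hy.2) (by simpa using hxy) hp hq hpq
    have e : 1 - (p • x + q • y) = p • (1 - x) + q • (1 - y) := by
      simp only [smul_eq_mul]
      linear_combination -hpq
    simpa only [toughReturn, e] using h

/-- The equilibrium effort in a school with average type `a` in which marginal returns to effort
are `M`: the largest effort whose marginal cost does not exceed its marginal return. -/
def inducedEffort (α : ℝ) (c M : ℝ → ℝ) (a : ℝ) : ℝ :=
  sSup {e ∈ Icc 0 (1 - α) | marginalCost α c e ≤ M (a + e)}

/-- Effort net of its cost at the equilibrium effort `inducedEffort α c M a`. -/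
def inducedSurplus (α : ℝ) (c M : ℝ → ℝ) (a : ℝ) : ℝ :=
  inducedEffort α c M a - c (inducedEffort α c M a)

lemma add_mem_Ioo_zero_one {α a e : ℝ} (ha : a ∈ Ioo 0 α) (he : e ∈ Icc 0 (1 - α)) :
    a + e ∈ Ioo (0 : ℝ) 1 :=
  ⟨by linarith [ha.1, he.1], by linarith [ha.2, he.2]⟩

namespace IsConcaveReturn

variable {α a e : ℝ} {c M : ℝ → ℝ}

/-- Marginal return minus marginal cost is concave in effort and positive at zero effort, so it
changes sign exactly once. -/
lemma inducedEffort_spec (hM : IsConcaveReturn M) (hc : IsCostFunction α c)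
    (hα : α ∈ Ioo (0 : ℝ) 1) (ha : a ∈ Ioo 0 α) :
    inducedEffort α c M a ∈ Ioo 0 (1 - α) ∧
      marginalCost α c (inducedEffort α c M a) = M (a + inducedEffort α c M a) ∧
      (∀ e ∈ Icc 0 (1 - α), marginalCost α c e ≤ M (a + e) ↔ e ≤ inducedEffort α c M a) ∧
      ∀ e ∈ Icc 0 (1 - α), e < inducedEffort α c M a → marginalCost α c e < M (a + e) := by
  obtain ⟨e₀, he₀, h⟩ := hc.exists_marginalCost_eq hα hM.continuousOn hM.pos
    (fun x hx => (hM.lt_one x hx).le) ha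
  have hR : 0 ≤ 1 - α := by linarith [hα.2]
  have h0mem : (0 : ℝ) ∈ Icc 0 (1 - α) := left_mem_Icc.2 hR
  set f : ℝ → ℝ := fun e => M (a + e) - marginalCost α c e with hf
  have hconc : ConcaveOn ℝ (Icc 0 (1 - α)) f := by
    refine ConcaveOn.sub ⟨convex_Icc _ _, fun x hx y hy p q hp hq hpq => ?_⟩
      hc.convexOn_marginalCost
    have := hM.strictConcaveOn.concaveOn.2 (add_mem_Ioo_zero_one ha hx)
      (add_mem_Ioo_zero_one ha hy) hp hq hpq
    have e : p • (a + x) + q • (a + y) = a + (p • x + q • y) := by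
      simp only [smul_eq_mul]
      linear_combination a * hpq
    rwa [e] at this
  have hf0 : 0 < f 0 := by
    have := hM.pos _ (add_mem_Ioo_zero_one ha h0mem)
    simp only [hf, hc.marginalCost_zero]
    linarith
  have hfe : f e₀ = 0 := by simp [hf, h]
  have hscale : ∀ x y : ℝ, 0 ≤ x → x < y → y ≤ 1 - α → 0 ≤ f y → 0 < f x := by
    intro x y hx hxy hy hfy
    have hy0 : 0 < y := hx.trans_lt hxy
    have ht : x / y < 1 := (div_lt_one hy0).2 hxy
    have ht0 : 0 ≤ x / y := by positivity
    have := hconc.2 h0mem (⟨hy0.le, hy⟩ : y ∈ Icc 0 (1 - α)) (sub_pos.2 ht).le ht0 (by ring)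
    simp only [smul_eq_mul, mul_zero, zero_add, div_mul_cancel₀ _ hy0.ne'] at this
    nlinarith [mul_pos (sub_pos.2 ht) hf0, mul_nonneg ht0 hfy]
  have hiff : ∀ e ∈ Icc 0 (1 - α), marginalCost α c e ≤ M (a + e) ↔ e ≤ e₀ := by
    intro e he
    rw [← sub_nonneg]
    constructor
    · intro h1
      by_contra! h2
      exact (hscale e₀ e he₀.1.le h2 he.2 h1).ne' hfe
    · intro h1
      rcases h1.eq_or_lt with rfl | h1
      · exact hfe.ge
      · exact (hscale e e₀ he.1 h1 he₀.2.le hfe.ge).le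
  have hset : {e ∈ Icc 0 (1 - α) | marginalCost α c e ≤ M (a + e)} = Icc 0 e₀ := by
    ext e
    constructor
    · rintro ⟨h1, h2⟩
      exact ⟨h1.1, (hiff e h1).1 h2⟩
    · rintro ⟨h1, h2⟩
      have he : e ∈ Icc 0 (1 - α) := ⟨h1, h2.trans he₀.2.le⟩
      exact ⟨he, (hiff e he).2 h2⟩
  have heq : inducedEffort α c M a = e₀ := by
    rw [inducedEffort, hset, csSup_Icc he₀.1.le]
  rw [heq]
  exact ⟨he₀, h, hiff, fun e he h1 => sub_pos.1 (hscale e e₀ he.1 h1 he₀.2.le hfe.ge)⟩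

lemma inducedEffort_mem (hM : IsConcaveReturn M) (hc : IsCostFunction α c)
    (hα : α ∈ Ioo (0 : ℝ) 1) (ha : a ∈ Ioo 0 α) :
    inducedEffort α c M a ∈ Icc 0 (1 - α) :=
  Ioo_subset_Icc_self (hM.inducedEffort_spec hc hα ha).1

lemma marginalCost_inducedEffort (hM : IsConcaveReturn M) (hc : IsCostFunction α c)
    (hα : α ∈ Ioo (0 : ℝ) 1) (ha : a ∈ Ioo 0 α) :
    marginalCost α c (inducedEffort α c M a) = M (a + inducedEffort α c M a) :=
  (hM.inducedEffort_spec hc hα ha).2.1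

lemma marginalCost_inducedEffort_lt_one (hM : IsConcaveReturn M) (hc : IsCostFunction α c)
    (hα : α ∈ Ioo (0 : ℝ) 1) (ha : a ∈ Ioo 0 α) :
    marginalCost α c (inducedEffort α c M a) < 1 := by
  rw [hM.marginalCost_inducedEffort hc hα ha]
  exact hM.lt_one _ (add_mem_Ioo_zero_one ha (hM.inducedEffort_mem hc hα ha))

lemma le_inducedEffort_iff (hM : IsConcaveReturn M) (hc : IsCostFunction α c)
    (hα : α ∈ Ioo (0 : ℝ) 1) (ha : a ∈ Ioo 0 α) (he : e ∈ Icc 0 (1 - α)) :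
    e ≤ inducedEffort α c M a ↔ marginalCost α c e ≤ M (a + e) :=
  ((hM.inducedEffort_spec hc hα ha).2.2.1 e he).symm

lemma eq_inducedEffort_iff (hM : IsConcaveReturn M) (hc : IsCostFunction α c)
    (hα : α ∈ Ioo (0 : ℝ) 1) (ha : a ∈ Ioo 0 α) (he : e ∈ Icc 0 (1 - α)) :
    e = inducedEffort α c M a ↔ marginalCost α c e = M (a + e) := by
  refine ⟨fun h => by rw [h]; exact hM.marginalCost_inducedEffort hc hα ha, fun h => ?_⟩
  refine ((hM.le_inducedEffort_iff hc hα ha he).2 h.le).eq_of_not_lt fun hlt => ?_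
  exact ((hM.inducedEffort_spec hc hα ha).2.2.2 e he hlt).ne h

lemma lt_inducedEffort_iff (hM : IsConcaveReturn M) (hc : IsCostFunction α c)
    (hα : α ∈ Ioo (0 : ℝ) 1) (ha : a ∈ Ioo 0 α) (he : e ∈ Icc 0 (1 - α)) :
    e < inducedEffort α c M a ↔ marginalCost α c e < M (a + e) := by
  rw [lt_iff_le_and_ne, lt_iff_le_and_ne, hM.le_inducedEffort_iff hc hα ha he, Ne, Ne,
    hM.eq_inducedEffort_iff hc hα ha he]

lemma surplus_le_inducedSurplus (hM : IsConcaveReturn M) (hc : IsCostFunction α c)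
    (hα : α ∈ Ioo (0 : ℝ) 1) (ha : a ∈ Ioo 0 α) (he : 0 ≤ e)
    (h : e ≤ inducedEffort α c M a) : e - c e ≤ inducedSurplus α c M a :=
  hc.surplus_le he (hM.inducedEffort_mem hc hα ha).2 h
    (hM.marginalCost_inducedEffort_lt_one hc hα ha).le

lemma surplus_lt_inducedSurplus (hM : IsConcaveReturn M) (hc : IsCostFunction α c)
    (hα : α ∈ Ioo (0 : ℝ) 1) (ha : a ∈ Ioo 0 α) (he : 0 ≤ e)
    (h : e < inducedEffort α c M a) : e - c e < inducedSurplus α c M a :=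
  hc.surplus_lt he (hM.inducedEffort_mem hc hα ha).2 h
    (hM.marginalCost_inducedEffort_lt_one hc hα ha).le

/-- Returns to effort are strictly concave in the prior and marginal cost is convex, so effort is
strictly concave in the average type. -/
lemma strictConcaveOn_inducedEffort (hM : IsConcaveReturn M) (hc : IsCostFunction α c)
    (hα : α ∈ Ioo (0 : ℝ) 1) : StrictConcaveOn ℝ (Ioo 0 α) (inducedEffort α c M) := by
  refine ⟨convex_Ioo _ _, fun x hx y hy hxy p q hp hq hpq => ?_⟩
  have hz : p • x + q • y ∈ Ioo 0 α := convex_Ioo _ _ hx hy hp.le hq.le hpq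
  have hex := hM.inducedEffort_mem hc hα hx
  have hey := hM.inducedEffort_mem hc hα hy
  have hkx := hM.marginalCost_inducedEffort hc hα hx
  have hky := hM.marginalCost_inducedEffort hc hα hy
  rw [hM.lt_inducedEffort_iff hc hα hz (convex_Icc _ _ hex hey hp.le hq.le hpq)]
  have hk := hc.convexOn_marginalCost.2 hex hey hp.le hq.le hpq
  rw [hkx, hky] at hk
  refine hk.trans_lt ?_
  -- equal priors would mean equal marginal costs, hence equal efforts and equal average types
  have hne : x + inducedEffort α c M x ≠ y + inducedEffort α c M y := by
    intro h
    have := hc.strictMonoOn_marginalCost.injOn hex hey (by rw [hkx, hky, h])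
    exact hxy (by linarith)
  have := hM.strictConcaveOn.2 (add_mem_Ioo_zero_one hx hex) (add_mem_Ioo_zero_one hy hey) hne
    hp hq hpq
  convert this using 2
  simp only [smul_eq_mul]
  ring

lemma strictConcaveOn_inducedSurplus (hM : IsConcaveReturn M) (hc : IsCostFunction α c)
    (hα : α ∈ Ioo (0 : ℝ) 1) : StrictConcaveOn ℝ (Ioo 0 α) (inducedSurplus α c M) := by
  refine ⟨convex_Ioo _ _, fun x hx y hy hxy p q hp hq hpq => ?_⟩
  have hz : p • x + q • y ∈ Ioo 0 α := convex_Ioo _ _ hx hy hp.le hq.le hpq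
  have hex := hM.inducedEffort_mem hc hα hx
  have hey := hM.inducedEffort_mem hc hα hy
  exact (hc.concaveOn_surplus.2 hex hey hp.le hq.le hpq).trans_lt
    (hM.surplus_lt_inducedSurplus hc hα hz (convex_Icc _ _ hex hey hp.le hq.le hpq).1
      ((hM.strictConcaveOn_inducedEffort hc hα).2 hx hy hxy hp hq hpq))

end IsConcaveReturn

section Monotonicity

variable {α b : ℝ} {c : ℝ → ℝ}

lemma strictMonoOn_lenientEffort (hc : IsCostFunction α c) (hα : α ∈ Ioo (0 : ℝ) 1)
    (hb : b ∈ Ioo (0 : ℝ) 1) :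
    StrictMonoOn (inducedEffort α c (lenientReturn b)) (Ioo 0 α) := by
  intro x hx y hy hxy
  have hM := isConcaveReturn_lenient hb
  have he := hM.inducedEffort_mem hc hα hx
  rw [hM.lt_inducedEffort_iff hc hα hy he, hM.marginalCost_inducedEffort hc hα hx,
    lenientReturn_lt_iff hb (add_mem_Ioo_zero_one hx he).1 (add_mem_Ioo_zero_one hy he).1]
  linarith

lemma strictAntiOn_toughEffort (hc : IsCostFunction α c) (hα : α ∈ Ioo (0 : ℝ) 1)
    (hb : b ∈ Ioo (0 : ℝ) 1) :
    StrictAntiOn (inducedEffort α c (toughReturn b)) (Ioo 0 α) := by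
  intro x hx y hy hxy
  have hM := isConcaveReturn_tough hb
  have he := hM.inducedEffort_mem hc hα hy
  rw [hM.lt_inducedEffort_iff hc hα hx he, hM.marginalCost_inducedEffort hc hα hy, toughReturn,
    toughReturn, lenientReturn_lt_iff hb (sub_pos.2 (add_mem_Ioo_zero_one hy he).2)
      (sub_pos.2 (add_mem_Ioo_zero_one hx he).2)]
  linarith

lemma strictMonoOn_lenientSurplus (hc : IsCostFunction α c) (hα : α ∈ Ioo (0 : ℝ) 1)
    (hb : b ∈ Ioo (0 : ℝ) 1) :
    StrictMonoOn (inducedSurplus α c (lenientReturn b)) (Ioo 0 α) := by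
  intro x hx y hy hxy
  have hM := isConcaveReturn_lenient hb
  exact hM.surplus_lt_inducedSurplus hc hα hy (hM.inducedEffort_mem hc hα hx).1
    (strictMonoOn_lenientEffort hc hα hb hx hy hxy)

lemma strictAntiOn_toughSurplus (hc : IsCostFunction α c) (hα : α ∈ Ioo (0 : ℝ) 1)
    (hb : b ∈ Ioo (0 : ℝ) 1) :
    StrictAntiOn (inducedSurplus α c (toughReturn b)) (Ioo 0 α) := by
  intro x hx y hy hxy
  have hM := isConcaveReturn_tough hb
  exact hM.surplus_lt_inducedSurplus hc hα hx (hM.inducedEffort_mem hc hα hy).1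
    (strictAntiOn_toughEffort hc hα hb hx hy hxy)

end Monotonicity

/-- Any effort below the one induced by the tough rule is the equilibrium effort for some rule
with no passes for unproductive students: choose `g` so that the return to effort is right. -/
lemma GradingRule.exists_marginalReturn_eq {b : ℝ} (hb : b ∈ Ioo (0 : ℝ) 1) {x m : ℝ}
    (hx : x ∈ Ioo (0 : ℝ) 1) (hm : 0 < m) (hmx : m ≤ toughReturn b x) :
    ∃ G : GradingRule b, G.g0 = 0 ∧ G.marginalReturn x = m := by
  have h3 : 0 < 1 - b + b * (1 - x) := by
    linarith [hb.2, mul_pos hb.1 (sub_pos.2 hx.2)]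
  have hm1 : m < 1 := hmx.trans_lt (lenientReturn_lt_one hb (sub_pos.2 hx.2))
  have hx1 := sub_pos.2 hx.2
  have hden : 0 < m + (1 - m) * (1 - x) := by nlinarith
  rw [toughReturn, lenientReturn, le_div_iff₀ h3] at hmx
  have hg0 : 0 < m / (m + (1 - m) * (1 - x)) := by positivity
  have hgb : m / (m + (1 - m) * (1 - x)) ≤ b := by
    rw [div_le_iff₀ hden]
    nlinarith
  refine ⟨⟨0, m / (m + (1 - m) * (1 - x)), ⟨le_rfl, zero_le_one⟩, ⟨hg0.le, hgb.trans hb.2.le⟩,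
    hg0, by linarith⟩, rfl, ?_⟩
  rw [marginalReturn_eq _ hx]
  simp only [passProb, mul_zero, add_zero, sub_zero]
  have h4 : 1 - x * (m / (m + (1 - m) * (1 - x))) = (1 - x) / (m + (1 - m) * (1 - x)) := by
    field_simp
    ring
  rw [h4]
  have := hx.1.ne'
  field_simp

/-! ### Conditional means of the type distribution -/

/-- Mean of the type distribution `F` conditional on a set of types. -/
def conditionalMean (F : Measure ℝ) (A : Set ℝ) : ℝ :=
  (∫ θ in A, θ ∂F) / F.real A

lemma setIntegral_pos_of_pos {F : Measure ℝ} {A : Set ℝ} (hAm : MeasurableSet A) (hF : 0 < F A) {f : ℝ → ℝ}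
    (hf : IntegrableOn f A F) (hpos : ∀ θ ∈ A, 0 < f θ) : 0 < ∫ θ in A, f θ ∂F := by
  rw [setIntegral_pos_iff_support_of_nonneg_ae _ hf]
  · have : Function.support f ∩ A = A := inter_eq_right.2 fun θ hθ => (hpos θ hθ).ne'
    rwa [this]
  · filter_upwards [ae_restrict_mem hAm] with θ hθ using (hpos θ hθ).le

lemma measure_Ioo_pos {α : ℝ} {F : Measure ℝ} (hF : F.support = Icc 0 α) {l u : ℝ} (hl : 0 ≤ l) (hu : u ≤ α)
    (h : l < u) : 0 < F (Ioo l u) := by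
  obtain ⟨x, hx⟩ := exists_between h
  have : x ∈ F.support := hF ▸ ⟨hl.trans hx.1.le, hx.2.le.trans hu⟩
  exact (Measure.mem_support_iff_forall x).1 this _ (Ioo_mem_nhds hx.1 hx.2)

lemma measure_Ioc_pos {α : ℝ} {F : Measure ℝ} (hF : F.support = Icc 0 α) {l u : ℝ} (hl : 0 ≤ l) (hu : u ≤ α)
    (h : l < u) : 0 < F (Ioc l u) :=
  (measure_Ioo_pos hF hl hu h).trans_le (measure_mono Ioo_subset_Ioc_self)

lemma Ioc_union_Ioo_eq {t u v : ℝ} (ht : u ≤ t) (h : t < v) : Ioc u t ∪ Ioo t v = Ioo u v := by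
  ext x
  simp only [mem_union, mem_Ioc, mem_Ioo]
  grind

lemma disjoint_Ioc_Ioo {u t v : ℝ} : Disjoint (Ioc u t) (Ioo t v) :=
  disjoint_left.2 fun _ h h' => (h.2.trans_lt h'.1).false

section ConditionalMean

variable {α : ℝ} {F : Measure ℝ} [IsProbabilityMeasure F]

lemma integrableOn_id_of_subset_Icc {A : Set ℝ} {l u : ℝ} (hA : A ⊆ Icc l u) :
    IntegrableOn (fun θ => θ) A F :=
  ((continuous_id.continuousOn (s := Icc l u)).integrableOn_compact isCompact_Icc).mono_set hA

lemma measureReal_pos_of_pos {A : Set ℝ} (hF : 0 < F A) : 0 < F.real A :=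
  ENNReal.toReal_pos hF.ne' (measure_ne_top _ _)

lemma conditionalMean_mem {A : Set ℝ} {l u : ℝ} (hAm : MeasurableSet A) (hA : A ⊆ Ioo l u)
    (hF : 0 < F A) : conditionalMean F A ∈ Ioo l u := by
  have hint := integrableOn_id_of_subset_Icc (F := F) (hA.trans Ioo_subset_Icc_self)
  have hm : 0 < F.real A := measureReal_pos_of_pos hF
  have hi (r : ℝ) : IntegrableOn (fun _ => r) A F := integrableOn_const (measure_ne_top _ _)
  constructor
  · have := setIntegral_pos_of_pos hAm hF (f := fun θ => θ - l) (hint.sub (hi l))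
      fun θ hθ => sub_pos.2 (hA hθ).1
    rw [integral_sub hint (hi l), setIntegral_const, smul_eq_mul] at this
    rw [conditionalMean, lt_div_iff₀ hm]
    linarith
  · have := setIntegral_pos_of_pos hAm hF (f := fun θ => u - θ) ((hi u).sub hint)
      fun θ hθ => sub_pos.2 (hA hθ).2
    rw [integral_sub (hi u) hint, setIntegral_const, smul_eq_mul] at this
    rw [conditionalMean, div_lt_iff₀ hm]
    linarith

lemma measureReal_mul_conditionalMean {A : Set ℝ} (hF : 0 < F A) :
    F.real A * conditionalMean F A = ∫ θ in A, θ ∂F :=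
  mul_div_cancel₀ _ (measureReal_pos_of_pos hF).ne'

/-- A set of types that lies below another one has the lower conditional mean. -/
lemma conditionalMean_le {A B : Set ℝ} (hA : A ⊆ Ioo 0 α) (hB : B ⊆ Ioo 0 α)
    (hFA : 0 < F A) (hFB : 0 < F B) (h : ∀ θ ∈ A, ∀ θ' ∈ B, θ ≤ θ') :
    conditionalMean F A ≤ conditionalMean F B := by
  obtain ⟨x, hx, h1⟩ := exists_setAverage_le hFA.ne' (measure_ne_top F A)
    (integrableOn_id_of_subset_Icc (hA.trans Ioo_subset_Icc_self))
  obtain ⟨y, hy, h2⟩ := exists_le_setAverage hFB.ne' (measure_ne_top F B)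
    (integrableOn_id_of_subset_Icc (hB.trans Ioo_subset_Icc_self))
  rw [setAverage_eq, smul_eq_mul, inv_mul_eq_div] at h1 h2
  exact h1.trans ((h x hx y hy).trans h2)

lemma measure_Ioo_eq_one [NullSingletonClass F] (hF : F.support = Icc 0 α) :
    F (Ioo 0 α) = 1 := by
  have h : F (Icc 0 α)ᶜ = 0 := by
    rw [← hF]
    exact Measure.measure_compl_support
  rw [measure_congr Ioo_ae_eq_Icc]
  exact (prob_compl_eq_zero_iff measurableSet_Icc).1 h

/-- Raising the cutoff raises the mean of the types above it. -/
lemma conditionalMean_Ioo_lt (hF : F.support = Icc 0 α) {t t' : ℝ} (ht : 0 ≤ t) (htt : t < t')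
    (ht' : t' < α) : conditionalMean F (Ioo t α) < conditionalMean F (Ioo t' α) := by
  have hq := measureReal_pos_of_pos (measure_Ioc_pos hF ht ht'.le htt)
  have hP := measureReal_pos_of_pos (measure_Ioo_pos hF (ht.trans htt.le) le_rfl ht')
  have hH := (conditionalMean_mem measurableSet_Ioo subset_rfl
    (measure_Ioo_pos hF (ht.trans htt.le) le_rfl ht')).1
  have hi1 : IntegrableOn (fun θ => θ) (Ioc t t') F :=
    integrableOn_id_of_subset_Icc Ioc_subset_Icc_self
  have hi2 : IntegrableOn (fun θ => θ) (Ioo t' α) F :=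
    integrableOn_id_of_subset_Icc Ioo_subset_Icc_self
  have hJ : ∫ θ in Ioc t t', θ ∂F ≤ t' * F.real (Ioc t t') := by
    have := setIntegral_mono_on hi1 (integrableOn_const (C := t') (measure_ne_top _ _))
      measurableSet_Ioc fun x hx => hx.2
    rwa [setIntegral_const, smul_eq_mul, mul_comm] at this
  unfold conditionalMean at hH ⊢
  rw [lt_div_iff₀ hP] at hH
  rw [← Ioc_union_Ioo_eq htt.le ht', setIntegral_union disjoint_Ioc_Ioo measurableSet_Ioo hi1 hi2,
    measureReal_union disjoint_Ioc_Ioo measurableSet_Ioo, div_lt_div_iff₀ (by positivity) hP]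
  nlinarith

lemma continuousOn_setIntegral_Ioc [NullSingletonClass F] (f : ℝ → ℝ) (hf : Continuous f) :
    ContinuousOn (fun t => ∫ θ in Ioc 0 t, f θ ∂F) (Icc 0 α) :=
  intervalIntegral.continuousOn_primitive (hf.continuousOn.integrableOn_compact isCompact_Icc)

lemma continuousOn_measureReal_Ioc [NullSingletonClass F] :
    ContinuousOn (fun t => F.real (Ioc 0 t)) (Icc 0 α) := by
  simpa using continuousOn_setIntegral_Ioc (F := F) (α := α) (fun _ => 1) continuous_const

lemma continuousOn_conditionalMean_Ioc [NullSingletonClass F] (hF : F.support = Icc 0 α) :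
    ContinuousOn (fun t => conditionalMean F (Ioc 0 t)) (Ioo 0 α) :=
  ((continuousOn_setIntegral_Ioc _ continuous_id).mono Ioo_subset_Icc_self).div
    (continuousOn_measureReal_Ioc.mono Ioo_subset_Icc_self)
    fun _ ht => (measureReal_pos_of_pos (measure_Ioc_pos hF le_rfl ht.2.le ht.1)).ne'

lemma exists_measureReal_Ioc_eq [NullSingletonClass F] (hα : 0 < α) (hF : F.support = Icc 0 α)
    {m : ℝ} (hm : m ∈ Ioo (0 : ℝ) 1) : ∃ t ∈ Ioo 0 α, F.real (Ioc 0 t) = m := by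
  have h1 : F.real (Ioc 0 α) = 1 := by
    rw [measureReal_def, ← measure_congr Ioo_ae_eq_Ioc, measure_Ioo_eq_one hF, ENNReal.toReal_one]
  refine intermediate_value_Ioo hα.le continuousOn_measureReal_Ioc ?_
  simpa [h1] using hm

/-- The pointwise comparison behind the rearrangement inequality. -/
lemma indicator_sub_nonneg {X : Set ℝ} (hX : X ⊆ Ioo 0 α) (t θ : ℝ) :
    0 ≤ X.indicator (fun θ => θ - t) θ - (Ioc 0 t).indicator (fun θ => θ - t) θ := by
  by_cases h1 : θ ∈ X <;> by_cases h2 : θ ∈ Ioc 0 t <;> simp only [h1, h2, indicator_of_mem,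
    indicator_of_notMem, not_false_eq_true, sub_self, sub_zero, zero_sub, le_refl]
  · have := (hX h1).1
    simp only [mem_Ioc, not_and, not_le] at h2
    exact (sub_pos.2 (h2 this)).le
  · linarith [h2.2]

lemma integral_indicator_sub {X : Set ℝ} (hXm : MeasurableSet X) (hX : X ⊆ Ioo 0 α) {t : ℝ}
    (hm : F.real X = F.real (Ioc 0 t)) :
    Integrable (fun θ => X.indicator (fun θ => θ - t) θ
      - (Ioc 0 t).indicator (fun θ => θ - t) θ) F ∧
    ∫ θ, (X.indicator (fun θ => θ - t) θ - (Ioc 0 t).indicator (fun θ => θ - t) θ) ∂F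
      = (∫ θ in X, θ ∂F) - ∫ θ in Ioc 0 t, θ ∂F := by
  have hi (A : Set ℝ) : IntegrableOn (fun _ => t) A F := integrableOn_const (measure_ne_top _ _)
  have h1 : IntegrableOn (fun θ => θ) X F :=
    integrableOn_id_of_subset_Icc (hX.trans Ioo_subset_Icc_self)
  have h2 : IntegrableOn (fun θ => θ) (Ioc 0 t) F :=
    integrableOn_id_of_subset_Icc Ioc_subset_Icc_self
  have i1 := (h1.sub (hi X)).integrable_indicator hXm
  have i2 := (h2.sub (hi (Ioc 0 t))).integrable_indicator measurableSet_Ioc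
  refine ⟨i1.sub i2, ?_⟩
  refine (integral_sub i1 i2).trans ?_
  rw [integral_indicator hXm, integral_indicator measurableSet_Ioc]
  simp only [Pi.sub_apply]
  rw [integral_sub h1 (hi X), integral_sub h2 (hi _), setIntegral_const, setIntegral_const, hm]
  ring

/-- Among the sets of types of a given mass, the lower tail has the smallest mean. -/
lemma setIntegral_Ioc_le {X : Set ℝ} (hXm : MeasurableSet X) (hX : X ⊆ Ioo 0 α) {t : ℝ}
    (hm : F.real X = F.real (Ioc 0 t)) : ∫ θ in Ioc 0 t, θ ∂F ≤ ∫ θ in X, θ ∂F := by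
  rw [← sub_nonneg, ← (integral_indicator_sub hXm hX hm).2]
  exact integral_nonneg fun θ => indicator_sub_nonneg hX t θ

/-- The lower tail is, up to a null set, the only set of types of its mass with its mean. -/
lemma ae_mem_iff_of_setIntegral_eq [NullSingletonClass F] {X : Set ℝ} (hXm : MeasurableSet X)
    (hX : X ⊆ Ioo 0 α) {t : ℝ} (hm : F.real X = F.real (Ioc 0 t))
    (h : ∫ θ in X, θ ∂F = ∫ θ in Ioc 0 t, θ ∂F) :
    ∀ᵐ θ ∂F, θ ∈ X ↔ θ ∈ Ioc 0 t := by
  obtain ⟨hint, heq⟩ := integral_indicator_sub hXm hX hm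
  rw [h, sub_self, integral_eq_zero_iff_of_nonneg (indicator_sub_nonneg hX t) hint] at heq
  have ht : ∀ᵐ θ ∂F, θ ≠ t := by simp [ae_iff]
  filter_upwards [heq, ht] with θ h1 h2
  have h2' := sub_ne_zero.2 h2
  by_cases h3 : θ ∈ X <;> by_cases h4 : θ ∈ Ioc 0 t <;>
    simp only [h3, h4, indicator_of_mem, indicator_of_notMem, not_false_eq_true, sub_zero,
      zero_sub, Pi.zero_apply, neg_eq_zero] at h1 ⊢
  · exact (h2' h1).elim
  · exact (h2' h1).elim

end ConditionalMean

/-! ### Equilibrium in a school system -/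

lemma GradingRule.marginalReturn_eq_toughReturn {b : ℝ} (G : GradingRule b)
    (hb : b ∈ Ioo (0 : ℝ) 1) (hG : G.g0 = 0) {x : ℝ} (hx : x ∈ Ioo (0 : ℝ) 1) :
    G.marginalReturn x = toughReturn G.g1 x := by
  have h1 : G.g1 ∈ Ioo (0 : ℝ) 1 :=
    ⟨by linarith [G.lt], by linarith [G.sub_le, hb.2]⟩
  have hx1 := sub_pos.2 hx.2
  have h2 : 0 < 1 - G.g1 + G.g1 * (1 - x) := by
    linarith [mul_pos h1.1 hx1, h1.2]
  rw [G.marginalReturn_eq hx, toughReturn, lenientReturn]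
  simp only [passProb, hG, mul_zero, add_zero, sub_zero]
  have h3 : 0 < 1 - x * G.g1 := by linarith
  have h4 := hx.1.ne'
  have h5 := h1.1.ne'
  rw [div_eq_div_iff (by positivity) h2.ne']
  ring

namespace SchoolSystem

variable {α b : ℝ} {F : Measure ℝ}

lemma measurableSet_students (σ : SchoolSystem α b F) (s : Fin σ.n) :
    MeasurableSet (σ.students s) :=
  measurableSet_Ioo.subtype_image (σ.measurable_φ (measurableSet_singleton s))

lemma students_subset (σ : SchoolSystem α b F) (s : Fin σ.n) : σ.students s ⊆ Ioo 0 α := by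
  rintro _ ⟨θ, -, rfl⟩
  exact θ.2

lemma mem_students_iff (σ : SchoolSystem α b F) (s : Fin σ.n) (θ : Ioo (0 : ℝ) α) :
    (θ : ℝ) ∈ σ.students s ↔ σ.φ θ = s := by
  rw [students, Subtype.val_injective.mem_set_image]
  rfl

lemma pairwise_disjoint_students (σ : SchoolSystem α b F) :
    Pairwise (Function.onFun Disjoint σ.students) := by
  intro s s' hne
  rw [Function.onFun, disjoint_left]
  rintro _ ⟨θ, hθ, rfl⟩ h
  rw [mem_students_iff] at h
  exact hne (hθ.symm.trans h)

lemma iUnion_students (σ : SchoolSystem α b F) : ⋃ s, σ.students s = Ioo 0 α := by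
  refine subset_antisymm (iUnion_subset σ.students_subset) fun θ hθ => ?_
  exact mem_iUnion.2 ⟨σ.φ ⟨θ, hθ⟩, (σ.mem_students_iff _ ⟨θ, hθ⟩).2 rfl⟩

lemma students_nonempty (σ : SchoolSystem α b F) (s : Fin σ.n) : (σ.students s).Nonempty :=
  nonempty_of_measure_ne_zero (σ.mass_pos s).ne'

variable [IsProbabilityMeasure F]

lemma mass_real_pos (σ : SchoolSystem α b F) (s : Fin σ.n) : 0 < σ.mass s :=
  measureReal_pos_of_pos (σ.mass_pos s)

lemma avgType_mem (σ : SchoolSystem α b F) (s : Fin σ.n) : σ.avgType s ∈ Ioo 0 α :=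
  conditionalMean_mem (σ.measurableSet_students s) (σ.students_subset s) (σ.mass_pos s)

lemma mass_mul_avgType (σ : SchoolSystem α b F) (s : Fin σ.n) :
    σ.mass s * σ.avgType s = ∫ θ in σ.students s, θ ∂F :=
  measureReal_mul_conditionalMean (σ.mass_pos s)

lemma measureReal_biUnion_students (σ : SchoolSystem α b F) (B : Finset (Fin σ.n)) :
    F.real (⋃ s ∈ B, σ.students s) = ∑ s ∈ B, σ.mass s :=
  measureReal_biUnion_finset (fun _ _ _ _ h => σ.pairwise_disjoint_students h)
    fun s _ => σ.measurableSet_students s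

lemma setIntegral_biUnion_students (σ : SchoolSystem α b F) (B : Finset (Fin σ.n)) :
    ∫ θ in ⋃ s ∈ B, σ.students s, θ ∂F = ∑ s ∈ B, σ.mass s * σ.avgType s := by
  rw [integral_biUnion_finset B (fun s _ => σ.measurableSet_students s)
    (fun _ _ _ _ h => σ.pairwise_disjoint_students h)
    fun s _ => integrableOn_id_of_subset_Icc ((σ.students_subset s).trans Ioo_subset_Icc_self)]
  simp only [mass_mul_avgType]

lemma sum_mass (σ : SchoolSystem α b F) [NullSingletonClass F] (hF : F.support = Icc 0 α) :
    ∑ s, σ.mass s = 1 := by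
  rw [← σ.measureReal_biUnion_students]
  simp [iUnion_students, measureReal_def, measure_Ioo_eq_one hF]

lemma sum_mass_mul_avgType (σ : SchoolSystem α b F) :
    ∑ s, σ.mass s * σ.avgType s = ∫ θ in Ioo 0 α, θ ∂F := by
  rw [← σ.setIntegral_biUnion_students]
  simp [iUnion_students]

/-- Aggregate effort net of its cost, the part of social welfare that depends on the system. -/
def surplus (c : ℝ → ℝ) (σ : SchoolSystem α b F) : ℝ :=
  ∑ s, σ.mass s * (σ.effort c s - c (σ.effort c s))

lemma welfare_eq (c : ℝ → ℝ) (σ : SchoolSystem α b F) :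
    σ.welfare c = (∫ θ in Ioo 0 α, θ ∂F) + σ.surplus c := by
  rw [← σ.sum_mass_mul_avgType, surplus, ← Finset.sum_add_distrib]
  exact Finset.sum_congr rfl fun s _ => by ring

lemma ConstrainedOptimal.surplus_le {c : ℝ → ℝ} {σ : SchoolSystem α b F}
    (hσ : σ.ConstrainedOptimal c) {σ' : SchoolSystem α b F} (h : σ'.IncentiveCompatible c) :
    σ'.surplus c ≤ σ.surplus c := by
  have := hσ.2 σ' h
  rwa [welfare_eq, welfare_eq, add_le_add_iff_left] at this

variable {c : ℝ → ℝ}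

lemma payoff_eq (σ : SchoolSystem α b F) (s : Fin σ.n) (θ e : ℝ) {ehat : ℝ}
    (he : ehat ∈ Icc 0 (1 - α)) :
    σ.payoff c s θ e ehat = σ.avgType s + ehat
      + (σ.G s).marginalReturn (σ.avgType s + ehat) * (θ + e - (σ.avgType s + ehat)) - c e := by
  rw [payoff, (σ.G s).expected_wage (add_mem_Ioo_zero_one (σ.avgType_mem s) he)]

/-- An effort is an equilibrium effort exactly when it satisfies the first-order condition; the
corner efforts are excluded by `c'(0) = 0` and `c'(1 - α) > 1`. -/
lemma isEquilibriumEffort_iff (hc : IsCostFunction α c) (hα : α ∈ Ioo (0 : ℝ) 1)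
    (hb : b ∈ Ioo (0 : ℝ) 1) (σ : SchoolSystem α b F) (s : Fin σ.n) {e : ℝ} :
    σ.IsEquilibriumEffort c s e ↔ e ∈ Icc 0 (1 - α) ∧
      marginalCost α c e = (σ.G s).marginalReturn (σ.avgType s + e) := by
  refine and_congr_right fun he => ?_
  have hx := add_mem_Ioo_zero_one (σ.avgType_mem s) he
  set D := (σ.G s).marginalReturn (σ.avgType s + e) with hD
  have hD0 : 0 < D := (σ.G s).marginalReturn_pos hx
  have hD1 : D < 1 := (σ.G s).marginalReturn_lt_one hb hx
  constructor
  · intro h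
    obtain ⟨θ, hθ⟩ := σ.students_nonempty s
    -- the unique best response to the return `D`
    obtain ⟨e₀, he₀, h₀⟩ := hc.exists_marginalCost_eq hα (M := fun _ => D) continuousOn_const
      (fun _ _ => hD0) (fun _ _ => hD1.le) (σ.avgType_mem s)
    have h1 := h θ hθ e₀ (Ioo_subset_Icc_self he₀)
    rw [σ.payoff_eq s _ _ he, σ.payoff_eq s _ _ he, ← hD] at h1
    by_cases hne : e = e₀
    · rw [hne, h₀]
    · have := hc.tangent_lt (Ioo_subset_Icc_self he₀) he hne
      rw [h₀] at this
      linarith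
  · intro h θ _ e' he'
    rw [σ.payoff_eq s _ _ he, σ.payoff_eq s _ _ he, ← hD, ← h]
    by_cases hne : e' = e
    · rw [hne]
    · linarith [hc.tangent_lt he he' hne]

lemma effort_spec (hc : IsCostFunction α c) (hα : α ∈ Ioo (0 : ℝ) 1) (hb : b ∈ Ioo (0 : ℝ) 1)
    (σ : SchoolSystem α b F) (s : Fin σ.n) :
    σ.effort c s ∈ Icc 0 (1 - α) ∧ marginalCost α c (σ.effort c s)
      = (σ.G s).marginalReturn (σ.avgType s + σ.effort c s) := by
  rw [← isEquilibriumEffort_iff hc hα hb]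
  refine Classical.epsilon_spec (p := σ.IsEquilibriumEffort c s) ?_
  obtain ⟨e, he, h⟩ := hc.exists_marginalCost_eq hα (σ.G s).continuousOn_marginalReturn
    (fun x hx => (σ.G s).marginalReturn_pos hx)
    (fun x hx => ((σ.G s).marginalReturn_lt_one hb hx).le) (σ.avgType_mem s)
  exact ⟨e, (isEquilibriumEffort_iff hc hα hb σ s).2 ⟨Ioo_subset_Icc_self he, h⟩⟩

lemma effort_eq_inducedEffort (hc : IsCostFunction α c) (hα : α ∈ Ioo (0 : ℝ) 1)
    (hb : b ∈ Ioo (0 : ℝ) 1) (σ : SchoolSystem α b F) (s : Fin σ.n) {M : ℝ → ℝ}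
    (hM : IsConcaveReturn M) (h : ∀ x ∈ Ioo (0 : ℝ) 1, (σ.G s).marginalReturn x = M x) :
    σ.effort c s = inducedEffort α c M (σ.avgType s) := by
  obtain ⟨h1, h2⟩ := effort_spec hc hα hb σ s
  rwa [hM.eq_inducedEffort_iff hc hα (σ.avgType_mem s) h1,
    ← h _ (add_mem_Ioo_zero_one (σ.avgType_mem s) h1)]

/-- Payoffs are affine in the type, with slope the marginal cost of the equilibrium effort. -/
lemma value_eq (hc : IsCostFunction α c) (hα : α ∈ Ioo (0 : ℝ) 1) (hb : b ∈ Ioo (0 : ℝ) 1)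
    (σ : SchoolSystem α b F) (s : Fin σ.n) (θ : ℝ) :
    σ.value c s θ = σ.avgType s + σ.effort c s - c (σ.effort c s)
      + marginalCost α c (σ.effort c s) * (θ - σ.avgType s) := by
  obtain ⟨h1, h2⟩ := effort_spec hc hα hb σ s
  rw [value, σ.payoff_eq s _ _ h1, ← h2]
  ring

/-- Single crossing: incentive compatibility sends higher types to schools with higher effort. -/
lemma IncentiveCompatible.le_of_effort_lt {σ : SchoolSystem α b F}
    (h : σ.IncentiveCompatible c) (hc : IsCostFunction α c) (hα : α ∈ Ioo (0 : ℝ) 1)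
    (hb : b ∈ Ioo (0 : ℝ) 1) {s s' : Fin σ.n} (hlt : σ.effort c s < σ.effort c s') {θ θ' : ℝ}
    (hθ : θ ∈ σ.students s) (hθ' : θ' ∈ σ.students s') : θ ≤ θ' := by
  obtain ⟨t, ht⟩ := h
  obtain ⟨θ, rfl, rfl⟩ := hθ
  obtain ⟨θ', rfl, rfl⟩ := hθ'
  have h1 := ht θ (σ.φ θ')
  have h2 := ht θ' (σ.φ θ)
  rw [value_eq hc hα hb, value_eq hc hα hb] at h1 h2
  have hk := hc.strictMonoOn_marginalCost (effort_spec hc hα hb σ (σ.φ θ)).1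
    (effort_spec hc hα hb σ (σ.φ θ')).1 hlt
  by_contra! hcon
  nlinarith

lemma IncentiveCompatible.avgType_le {σ : SchoolSystem α b F}
    (h : σ.IncentiveCompatible c) (hc : IsCostFunction α c) (hα : α ∈ Ioo (0 : ℝ) 1)
    (hb : b ∈ Ioo (0 : ℝ) 1) {s s' : Fin σ.n} (hlt : σ.effort c s < σ.effort c s') :
    σ.avgType s ≤ σ.avgType s' :=
  conditionalMean_le (σ.students_subset s) (σ.students_subset s') (σ.mass_pos s) (σ.mass_pos s')
    fun _ hθ _ hθ' => h.le_of_effort_lt hc hα hb hlt hθ hθ'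

/-- No grading rule induces more effort than both the lenient and the tough one. -/
lemma effort_le_max (hc : IsCostFunction α c) (hα : α ∈ Ioo (0 : ℝ) 1) (hb : b ∈ Ioo (0 : ℝ) 1)
    (σ : SchoolSystem α b F) (s : Fin σ.n) :
    σ.effort c s ≤ max (inducedEffort α c (lenientReturn b) (σ.avgType s))
      (inducedEffort α c (toughReturn b) (σ.avgType s)) := by
  obtain ⟨h1, h2⟩ := effort_spec hc hα hb σ s
  have ha := σ.avgType_mem s
  have hx := add_mem_Ioo_zero_one ha h1
  rw [le_max_iff, (isConcaveReturn_lenient hb).le_inducedEffort_iff hc hα ha h1,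
    (isConcaveReturn_tough hb).le_inducedEffort_iff hc hα ha h1, h2]
  rcases le_total (1 / 2) (σ.avgType s + σ.effort c s) with h | h
  · exact Or.inl ((σ.G s).marginalReturn_le_lenient hb hx h)
  · exact Or.inr ((σ.G s).marginalReturn_le_tough hb hx h)

end SchoolSystem

/-! ### Systems with one school and with a cutoff type -/

namespace SchoolSystem

variable {α b : ℝ} {F : Measure ℝ}

/-- The system in which all students attend one school, with grading rule `G`. -/
def pooled (α : ℝ) (G : GradingRule b) (h : 0 < F (Ioo 0 α)) : SchoolSystem α b F where
  n := 1
  φ _ := 0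
  measurable_φ := measurable_const
  G _ := G
  mass_pos s := by
    have : (fun _ : Ioo (0 : ℝ) α => (0 : Fin 1)) ⁻¹' {s} = univ := by
      ext θ
      simp [Subsingleton.elim s 0]
    rwa [this, image_univ, Subtype.range_coe]

lemma students_pooled (G : GradingRule b) (h : 0 < F (Ioo 0 α)) (s : Fin 1) :
    (pooled α G h).students s = Ioo 0 α := by
  rw [← (pooled α G h).iUnion_students]
  exact (iUnion_eq_const fun i =>
    congrArg (pooled α G h).students (Subsingleton.elim (α := Fin 1) i s)).symm

/-- The students of school `0` of a system with a cutoff type. -/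
lemma image_preimage_cutoff_zero {t : ℝ} (ht : t ∈ Ioo 0 α) :
    Subtype.val '' ((fun θ : Ioo (0 : ℝ) α => if (θ : ℝ) ≤ t then (0 : Fin 2) else 1) ⁻¹' {0})
      = Ioc 0 t := by
  ext x
  constructor
  · rintro ⟨θ, hθ, rfl⟩
    refine ⟨θ.2.1, ?_⟩
    by_contra h
    simp [h] at hθ
  · intro hx
    exact ⟨⟨x, hx.1, hx.2.trans_lt ht.2⟩, by simp [hx.2], rfl⟩

/-- The students of school `1` of a system with a cutoff type. -/
lemma image_preimage_cutoff_one {t : ℝ} (ht : t ∈ Ioo 0 α) :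
    Subtype.val '' ((fun θ : Ioo (0 : ℝ) α => if (θ : ℝ) ≤ t then (0 : Fin 2) else 1) ⁻¹' {1})
      = Ioo t α := by
  ext x
  constructor
  · rintro ⟨θ, hθ, rfl⟩
    refine ⟨?_, θ.2.2⟩
    by_contra h
    simp [not_lt.1 h] at hθ
  · intro hx
    exact ⟨⟨x, ht.1.trans hx.1, hx.2⟩, by simp [hx.1], rfl⟩

/-- The system with two schools in which the types up to the cutoff `t` attend school `0`, with
grading rule `G₀`, and the types above it attend school `1`, with grading rule `G₁`. -/
def cutoff (hF : F.support = Icc 0 α) {t : ℝ} (ht : t ∈ Ioo 0 α) (G₀ G₁ : GradingRule b) :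
    SchoolSystem α b F where
  n := 2
  φ θ := if (θ : ℝ) ≤ t then 0 else 1
  measurable_φ := Measurable.ite (measurableSet_le measurable_subtype_coe measurable_const)
    measurable_const measurable_const
  G := ![G₀, G₁]
  mass_pos s := by
    fin_cases s
    · simp only [Fin.zero_eta, image_preimage_cutoff_zero ht]
      exact measure_Ioc_pos hF le_rfl ht.2.le ht.1
    · simp only [Fin.mk_one, image_preimage_cutoff_one ht]
      exact measure_Ioo_pos hF ht.1.le le_rfl ht.2

variable (hF : F.support = Icc 0 α) {t : ℝ} (ht : t ∈ Ioo 0 α) (G₀ G₁ : GradingRule b)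

lemma students_cutoff_zero : (cutoff hF ht G₀ G₁).students (0 : Fin 2) = Ioc 0 t :=
  image_preimage_cutoff_zero ht

lemma students_cutoff_one : (cutoff hF ht G₀ G₁).students (1 : Fin 2) = Ioo t α :=
  image_preimage_cutoff_one ht

lemma mass_cutoff_zero : (cutoff hF ht G₀ G₁).mass (0 : Fin 2) = F.real (Ioc 0 t) :=
  congrArg F.real (students_cutoff_zero hF ht G₀ G₁)

lemma mass_cutoff_one : (cutoff hF ht G₀ G₁).mass (1 : Fin 2) = F.real (Ioo t α) :=
  congrArg F.real (students_cutoff_one hF ht G₀ G₁)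

lemma avgType_cutoff_zero :
    (cutoff hF ht G₀ G₁).avgType (0 : Fin 2) = conditionalMean F (Ioc 0 t) :=
  congrArg (conditionalMean F) (students_cutoff_zero hF ht G₀ G₁)

lemma avgType_cutoff_one :
    (cutoff hF ht G₀ G₁).avgType (1 : Fin 2) = conditionalMean F (Ioo t α) :=
  congrArg (conditionalMean F) (students_cutoff_one hF ht G₀ G₁)

variable {c : ℝ → ℝ}

lemma incentiveCompatible_pooled (G : GradingRule b) (h : 0 < F (Ioo 0 α)) :
    (pooled α G h).IncentiveCompatible c :=
  ⟨fun _ => 0, fun θ s => by rw [Subsingleton.elim (α := Fin 1) s ((pooled α G h).φ θ)]⟩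

variable [IsProbabilityMeasure F]

/-- A cutoff system with weakly more effort in the upper school is implemented by the fee that
makes the cutoff type indifferent. -/
lemma incentiveCompatible_cutoff (hc : IsCostFunction α c) (hα : α ∈ Ioo (0 : ℝ) 1)
    (hb : b ∈ Ioo (0 : ℝ) 1)
    (h : (cutoff hF ht G₀ G₁).effort c (0 : Fin 2) ≤ (cutoff hF ht G₀ G₁).effort c (1 : Fin 2)) :
    (cutoff hF ht G₀ G₁).IncentiveCompatible c := by
  set σ := cutoff hF ht G₀ G₁
  have hk := hc.strictMonoOn_marginalCost.monotoneOn (effort_spec hc hα hb σ (0 : Fin 2)).1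
    (effort_spec hc hα hb σ (1 : Fin 2)).1 h
  have h0 := value_eq hc hα hb σ (0 : Fin 2)
  have h1 := value_eq hc hα hb σ (1 : Fin 2)
  refine ⟨(![0, σ.value c (1 : Fin 2) t - σ.value c (0 : Fin 2) t] : Fin 2 → ℝ),
    fun θ (s : Fin 2) => ?_⟩
  have hφ : σ.φ θ = (if (θ : ℝ) ≤ t then (0 : Fin 2) else 1) := rfl
  rw [hφ]
  split_ifs with hle
  · fin_cases s
    · exact le_rfl
    · simp only [Fin.mk_one, Matrix.cons_val_one, Matrix.cons_val_zero, Matrix.cons_val_fin_one]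
      rw [h0, h0, h1, h1]
      nlinarith
  · rw [not_le] at hle
    fin_cases s
    · simp only [Fin.zero_eta, Matrix.cons_val_one, Matrix.cons_val_zero, Matrix.cons_val_fin_one]
      rw [h0, h0, h1, h1]
      nlinarith
    · exact le_rfl

variable {σ : SchoolSystem α b F}

lemma ConstrainedOptimal.inducedSurplus_le_surplus (hσ : σ.ConstrainedOptimal c)
    (hc : IsCostFunction α c) (hα : α ∈ Ioo (0 : ℝ) 1) (hb : b ∈ Ioo (0 : ℝ) 1)
    [NullSingletonClass F] {M : ℝ → ℝ} (hF : F.support = Icc 0 α) (hM : IsConcaveReturn M)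
    (G : GradingRule b) (hG : ∀ x ∈ Ioo (0 : ℝ) 1, G.marginalReturn x = M x) :
    inducedSurplus α c M (∫ θ in Ioo 0 α, θ ∂F) ≤ σ.surplus c := by
  have h1 := measure_Ioo_eq_one hF
  have hpos : 0 < F (Ioo 0 α) := by simp [h1]
  refine le_of_eq_of_le ?_ (hσ.surplus_le (incentiveCompatible_pooled G hpos))
  have hm : (pooled α G hpos).mass (0 : Fin 1) = 1 :=
    (congrArg F.real (students_pooled G hpos _)).trans (by simp [measureReal_def, h1])
  have ha : (pooled α G hpos).avgType (0 : Fin 1) = ∫ θ in Ioo 0 α, θ ∂F :=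
    (congrArg (conditionalMean F) (students_pooled G hpos _)).trans
      (by simp [conditionalMean, measureReal_def, h1])
  have he := effort_eq_inducedEffort hc hα hb (pooled α G hpos) (0 : Fin 1) hM hG
  rw [surplus]
  refine Eq.trans ?_ (Fin.sum_univ_one _).symm
  rw [hm, one_mul, he, ha, inducedSurplus]

/-- A lower bound for the optimum: lenient grading above a cutoff, and below it any effort that
is weakly smaller and does not exceed the effort under tough grading. -/
lemma ConstrainedOptimal.cutoff_surplus_le (hσ : σ.ConstrainedOptimal c)
    (hc : IsCostFunction α c) (hα : α ∈ Ioo (0 : ℝ) 1) (hb : b ∈ Ioo (0 : ℝ) 1)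
    (hF : F.support = Icc 0 α) {t e : ℝ} (ht : t ∈ Ioo 0 α) (he : 0 < e)
    (heT : e ≤ inducedEffort α c (toughReturn b) (conditionalMean F (Ioc 0 t)))
    (heL : e ≤ inducedEffort α c (lenientReturn b) (conditionalMean F (Ioo t α))) :
    F.real (Ioc 0 t) * (e - c e) + F.real (Ioo t α) *
      inducedSurplus α c (lenientReturn b) (conditionalMean F (Ioo t α)) ≤ σ.surplus c := by
  have hlow : conditionalMean F (Ioc 0 t) ∈ Ioo 0 α :=
    conditionalMean_mem measurableSet_Ioc (fun x hx => ⟨hx.1, hx.2.trans_lt ht.2⟩)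
      (measure_Ioc_pos hF le_rfl ht.2.le ht.1)
  have hT := isConcaveReturn_tough hb
  have hR : e ∈ Icc 0 (1 - α) := ⟨he.le, heT.trans (hT.inducedEffort_mem hc hα hlow).2⟩
  have hx := add_mem_Ioo_zero_one hlow hR
  have hk0 : 0 < marginalCost α c e := by
    rw [← hc.marginalCost_zero]
    exact hc.strictMonoOn_marginalCost (left_mem_Icc.2 (hR.1.trans hR.2)) hR he
  obtain ⟨G, hG0, hG⟩ := GradingRule.exists_marginalReturn_eq hb hx hk0
    ((hT.le_inducedEffort_iff hc hα hlow hR).1 heT)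
  set σ' := cutoff hF ht G (GradingRule.lenient b hb)
  have ha0 : σ'.avgType (0 : Fin 2) = conditionalMean F (Ioc 0 t) := avgType_cutoff_zero hF ht _ _
  have ha1 : σ'.avgType (1 : Fin 2) = conditionalMean F (Ioo t α) := avgType_cutoff_one hF ht _ _
  have hG1 : G.g1 ∈ Ioo (0 : ℝ) 1 := ⟨by linarith [G.lt], by linarith [G.sub_le, hb.2]⟩
  have hTG := isConcaveReturn_tough hG1
  have he0 : σ'.effort c (0 : Fin 2) = e := by
    rw [effort_eq_inducedEffort hc hα hb σ' (0 : Fin 2) hTG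
      fun x hx => G.marginalReturn_eq_toughReturn hb hG0 hx, ha0, eq_comm,
      hTG.eq_inducedEffort_iff hc hα hlow hR, ← hG, G.marginalReturn_eq_toughReturn hb hG0 hx]
  have he1 : σ'.effort c (1 : Fin 2)
      = inducedEffort α c (lenientReturn b) (conditionalMean F (Ioo t α)) := by
    rw [effort_eq_inducedEffort hc hα hb σ' (1 : Fin 2) (isConcaveReturn_lenient hb)
      fun x hx => GradingRule.marginalReturn_lenient hb hx, ha1]
  refine le_of_eq_of_le ?_ (hσ.surplus_le
    (incentiveCompatible_cutoff hF ht _ _ hc hα hb (he0.trans_le (heL.trans_eq he1.symm))))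
  rw [surplus]
  refine Eq.trans ?_ (Fin.sum_univ_two _).symm
  have hm0 : σ'.mass (0 : Fin 2) = F.real (Ioc 0 t) := mass_cutoff_zero hF ht _ _
  have hm1 : σ'.mass (1 : Fin 2) = F.real (Ioo t α) := mass_cutoff_one hF ht _ _
  rw [he0, he1, hm0, hm1, inducedSurplus]

end SchoolSystem

/-! ### The structure of constrained-optimal systems -/

/-- Jensen's inequality and its equality case, for weights that need not add up to `1`. -/
lemma StrictConcaveOn.sum_mul_le {ι : Type*} {A : Set ℝ} {f : ℝ → ℝ}
    (hf : StrictConcaveOn ℝ A f) {B : Finset ι} (hB : B.Nonempty) {m p : ι → ℝ}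
    (hm : ∀ i ∈ B, 0 < m i) (hp : ∀ i ∈ B, p i ∈ A) :
    ∑ i ∈ B, m i * f (p i) ≤ (∑ i ∈ B, m i) * f ((∑ i ∈ B, m i * p i) / ∑ i ∈ B, m i) ∧
    ((∑ i ∈ B, m i) * f ((∑ i ∈ B, m i * p i) / ∑ i ∈ B, m i) ≤ ∑ i ∈ B, m i * f (p i) →
      ∀ j ∈ B, p j = (∑ i ∈ B, m i * p i) / ∑ i ∈ B, m i) := by
  set S := ∑ i ∈ B, m i with hS
  have hS0 : 0 < S := Finset.sum_pos hm hB
  have hw : ∀ i ∈ B, 0 < m i / S := fun i hi => div_pos (hm i hi) hS0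
  have hw1 : ∑ i ∈ B, m i / S = 1 := by
    rw [← Finset.sum_div, div_self hS0.ne']
  have e1 : ∑ i ∈ B, (m i / S) • p i = (∑ i ∈ B, m i * p i) / S := by
    rw [Finset.sum_div]
    exact Finset.sum_congr rfl fun i _ => by rw [smul_eq_mul]; ring
  have e2 : ∑ i ∈ B, (m i / S) • f (p i) = (∑ i ∈ B, m i * f (p i)) / S := by
    rw [Finset.sum_div]
    exact Finset.sum_congr rfl fun i _ => by rw [smul_eq_mul]; ring
  have h1 := hf.concaveOn.le_map_sum (fun i hi => (hw i hi).le) hw1 hp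
  rw [e1, e2, div_le_iff₀ hS0] at h1
  refine ⟨by linarith, fun h => ?_⟩
  have h2 := (hf.map_sum_eq_iff hw hw1 hp).1
  rw [e1, e2] at h2
  exact h2 (by rw [eq_div_iff hS0.ne']; linarith)

namespace SchoolSystem

variable {α b : ℝ} {F : Measure ℝ} [IsProbabilityMeasure F] [NullSingletonClass F] {c : ℝ → ℝ}
  {σ : SchoolSystem α b F}

/-- If one of the two extreme rules is at least as good as the actual one in every school, then
pooling all students under it is a strict improvement, unless average types are all equal. -/
lemma ConstrainedOptimal.isSingleTier_of_effort_le (hσ : σ.ConstrainedOptimal c)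
    (hc : IsCostFunction α c) (hα : α ∈ Ioo (0 : ℝ) 1) (hb : b ∈ Ioo (0 : ℝ) 1)
    (hF : F.support = Icc 0 α) {M : ℝ → ℝ} (hM : IsConcaveReturn M) (G : GradingRule b)
    (hG : ∀ x ∈ Ioo (0 : ℝ) 1, G.marginalReturn x = M x)
    (h : ∀ s, σ.effort c s ≤ inducedEffort α c M (σ.avgType s)) : σ.IsSingleTier := by
  intro s s'
  have hopt := hσ.inducedSurplus_le_surplus hc hα hb hF hM G hG
  have hle : σ.surplus c ≤ ∑ s, σ.mass s * inducedSurplus α c M (σ.avgType s) :=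
    Finset.sum_le_sum fun s _ => mul_le_mul_of_nonneg_left
      (hM.surplus_le_inducedSurplus hc hα (σ.avgType_mem s) (effort_spec hc hα hb σ s).1.1 (h s))
      (σ.mass_real_pos s).le
  have hJ := ((hM.strictConcaveOn_inducedSurplus hc hα).sum_mul_le
    (B := Finset.univ) ⟨s, Finset.mem_univ s⟩ (fun s _ => σ.mass_real_pos s)
    fun s _ => σ.avgType_mem s).2
  rw [σ.sum_mass hF, σ.sum_mass_mul_avgType, one_mul, div_one] at hJ
  have := hJ (hopt.trans hle)
  rw [this s (Finset.mem_univ s), this s' (Finset.mem_univ s')]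

/-- If, at a cutoff, tough grading below would induce more effort than lenient grading above,
then the effort of the upper school can be attained by everyone; raising the cutoff slightly
raises this common effort, so its surplus is strictly below the optimum. -/
lemma ConstrainedOptimal.lenientSurplus_lt (hσ : σ.ConstrainedOptimal c)
    (hc : IsCostFunction α c) (hα : α ∈ Ioo (0 : ℝ) 1) (hb : b ∈ Ioo (0 : ℝ) 1)
    (hF : F.support = Icc 0 α) {t : ℝ} (ht : t ∈ Ioo 0 α)
    (h : inducedEffort α c (lenientReturn b) (conditionalMean F (Ioo t α))
      < inducedEffort α c (toughReturn b) (conditionalMean F (Ioc 0 t))) :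
    inducedSurplus α c (lenientReturn b) (conditionalMean F (Ioo t α)) < σ.surplus c := by
  have hL := isConcaveReturn_lenient hb
  have hT := isConcaveReturn_tough hb
  have hlow : ∀ u ∈ Ioo 0 α, conditionalMean F (Ioc 0 u) ∈ Ioo 0 α := fun u hu =>
    conditionalMean_mem measurableSet_Ioc (fun x hx => ⟨hx.1, hx.2.trans_lt hu.2⟩)
      (measure_Ioc_pos hF le_rfl hu.2.le hu.1)
  have hhigh : ∀ u ∈ Ioo 0 α, conditionalMean F (Ioo u α) ∈ Ioo 0 α := fun u hu =>
    conditionalMean_mem measurableSet_Ioo (fun x hx => ⟨hu.1.trans hx.1, hx.2⟩)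
      (measure_Ioo_pos hF hu.1.le le_rfl hu.2)
  set e₀ := inducedEffort α c (lenientReturn b) (conditionalMean F (Ioo t α)) with he₀
  have hmem : e₀ ∈ Icc 0 (1 - α) := hL.inducedEffort_mem hc hα (hhigh t ht)
  rw [hT.lt_inducedEffort_iff hc hα (hlow t ht) hmem] at h
  have hcont : ContinuousAt (fun u => toughReturn b (conditionalMean F (Ioc 0 u) + e₀)) t := by
    have h1 : ContinuousAt (fun u => conditionalMean F (Ioc 0 u) + e₀) t :=
      ((continuousOn_conditionalMean_Ioc hF).continuousAt (Ioo_mem_nhds ht.1 ht.2)).add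
        continuousAt_const
    have hx := add_mem_Ioo_zero_one (hlow t ht) hmem
    exact ContinuousAt.comp (g := toughReturn b)
      (hT.continuousOn.continuousAt (Ioo_mem_nhds hx.1 hx.2)) h1
  obtain ⟨u, hu, hut⟩ := (((hcont.eventually (lt_mem_nhds h)).filter_mono
    nhdsWithin_le_nhds).and (Ioo_mem_nhdsGT ht.2)).exists
  have hu' : u ∈ Ioo 0 α := ⟨ht.1.trans hut.1, hut.2⟩
  rw [← hT.lt_inducedEffort_iff hc hα (hlow u hu') hmem] at hu
  have hu2 := strictMonoOn_lenientEffort hc hα hb (hhigh t ht) (hhigh u hu')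
    (conditionalMean_Ioo_lt hF ht.1.le hut.1 hut.2)
  rw [← he₀] at hu2
  set e := min (inducedEffort α c (toughReturn b) (conditionalMean F (Ioc 0 u)))
    (inducedEffort α c (lenientReturn b) (conditionalMean F (Ioo u α))) with he
  have hlt : e₀ < e := lt_min hu hu2
  have hk : marginalCost α c e ≤ 1 := by
    refine (hc.strictMonoOn_marginalCost.monotoneOn ⟨hmem.1.trans hlt.le, (min_le_right _ _).trans
      (hL.inducedEffort_mem hc hα (hhigh u hu')).2⟩ (hL.inducedEffort_mem hc hα (hhigh u hu'))
      (min_le_right _ _)).trans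
      (hL.marginalCost_inducedEffort_lt_one hc hα (hhigh u hu')).le
  have h1 : e₀ - c e₀ < e - c e := hc.surplus_lt hmem.1 ((min_le_right _ _).trans
      (hL.inducedEffort_mem hc hα (hhigh u hu')).2) hlt hk
  have h2 := hL.surplus_le_inducedSurplus hc hα (hhigh u hu') (hmem.1.trans hlt.le)
    (min_le_right _ _ : e ≤ _)
  have h3 := hσ.cutoff_surplus_le hc hα hb hF hu' (hmem.1.trans_lt hlt) (min_le_left _ _)
    (min_le_right _ _)
  have hmass : F.real (Ioc 0 u) + F.real (Ioo u α) = 1 := by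
    rw [← measureReal_union disjoint_Ioc_Ioo measurableSet_Ioo, Ioc_union_Ioo_eq hu'.1.le hu'.2,
      measureReal_def, measure_Ioo_eq_one hF, ENNReal.toReal_one]
  have h4 := mul_le_mul_of_nonneg_left h2 (measureReal_nonneg (μ := F) (s := Ioo u α))
  have h5 : e - c e = F.real (Ioc 0 u) * (e - c e) + F.real (Ioo u α) * (e - c e) := by
    rw [← add_mul, hmass, one_mul]
  change e₀ - c e₀ < _
  linarith

end SchoolSystem

/-! ### Tough and lenient schools -/

namespace SchoolSystem

variable {α b : ℝ} {F : Measure ℝ} {c : ℝ → ℝ} {σ : SchoolSystem α b F}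

/-- The schools for whose average type tough grading induces strictly more effort than lenient
grading. -/
def toughSchools (c : ℝ → ℝ) (σ : SchoolSystem α b F) : Finset (Fin σ.n) :=
  Finset.univ.filter fun s => inducedEffort α c (lenientReturn b) (σ.avgType s)
    < inducedEffort α c (toughReturn b) (σ.avgType s)

/-- The schools for whose average type lenient grading induces at least as much effort as tough
grading. -/
def lenientSchools (c : ℝ → ℝ) (σ : SchoolSystem α b F) : Finset (Fin σ.n) :=
  Finset.univ.filter fun s => ¬ inducedEffort α c (lenientReturn b) (σ.avgType s)
    < inducedEffort α c (toughReturn b) (σ.avgType s)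

/-- The conclusions about a constrained-optimal system that has both kinds of schools: all schools
of a kind share their average type and have the largest effort attainable with it, and the
students of the two kinds are separated by the cutoff type `t`. -/
structure IsSortedAt (c : ℝ → ℝ) (σ : SchoolSystem α b F) (t lo hi : ℝ) : Prop where
  avg_tough : ∀ s ∈ σ.toughSchools c, σ.avgType s = lo
  avg_lenient : ∀ s ∈ σ.lenientSchools c, σ.avgType s = hi
  effort_tough : ∀ s ∈ σ.toughSchools c, σ.effort c s = inducedEffort α c (toughReturn b) lo
  effort_lenient : ∀ s ∈ σ.lenientSchools c, σ.effort c s = inducedEffort α c (lenientReturn b) hi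
  effort_le : inducedEffort α c (toughReturn b) lo ≤ inducedEffort α c (lenientReturn b) hi
  ae_mem_iff : ∀ᵐ θ ∂F, θ ∈ (⋃ s ∈ σ.toughSchools c, σ.students s) ↔ θ ∈ Ioc 0 t

lemma sum_tough_add_sum_lenient (f : Fin σ.n → ℝ) :
    ∑ s ∈ σ.toughSchools c, f s + ∑ s ∈ σ.lenientSchools c, f s = ∑ s, f s :=
  Finset.sum_filter_add_sum_filter_not _ _ _

lemma IsSortedAt.isTwoTierWith {t lo hi : ℝ} (h : σ.IsSortedAt c t lo hi) (hlt : lo < hi)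
    (hT0 : (σ.toughSchools c).Nonempty) (hL0 : (σ.lenientSchools c).Nonempty) :
    σ.IsTwoTierWith (σ.toughSchools c) (σ.lenientSchools c) where
  bottom_nonempty := hT0
  top_nonempty := hL0
  disjoint := by
    rw [Finset.disjoint_coe]
    exact Finset.disjoint_filter_filter_not _ _ _
  union_eq := by
    rw [← Finset.coe_union, toughSchools, lenientSchools, Finset.filter_union_filter_not_eq,
      Finset.coe_univ]
  bottom_avg s hs s' hs' := by rw [h.avg_tough s hs, h.avg_tough s' hs']
  top_avg s hs s' hs' := by rw [h.avg_lenient s hs, h.avg_lenient s' hs']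
  avg_lt s hs s' hs' := by rwa [h.avg_tough s hs, h.avg_lenient s' hs']
  sorted := by
    refine ⟨_, ae_iff.1 h.ae_mem_iff, fun θ θ' hθ hθ' hS hT => ?_⟩
    simp only [mem_ofPred_eq, not_not] at hθ hθ'
    have h1 : (θ : ℝ) ∈ Ioc 0 t :=
      hθ.1 (mem_iUnion₂.2 ⟨σ.φ θ, hS, (σ.mem_students_iff _ _).2 rfl⟩)
    have h2 : ¬ (θ' : ℝ) ∈ Ioc 0 t := fun hmem => by
      obtain ⟨s, hs, hs'⟩ := mem_iUnion₂.1 (hθ'.2 hmem)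
      rw [mem_students_iff] at hs'
      simp only [lenientSchools, Finset.coe_filter, Finset.mem_univ, true_and,
        mem_ofPred_eq] at hT
      simp only [toughSchools, Finset.mem_filter, Finset.mem_univ, true_and] at hs
      rw [hs'] at hT
      exact hT hs
    have h3 : t < θ' := by
      by_contra! hle
      exact h2 ⟨θ'.2.1, hle⟩
    exact Subtype.coe_le_coe.1 (h1.2.trans h3.le)

variable [IsProbabilityMeasure F]

lemma avgType_lt_of_mem (hc : IsCostFunction α c) (hα : α ∈ Ioo (0 : ℝ) 1)
    (hb : b ∈ Ioo (0 : ℝ) 1) {s s' : Fin σ.n} (hs : s ∈ σ.toughSchools c)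
    (hs' : s' ∈ σ.lenientSchools c) : σ.avgType s < σ.avgType s' := by
  by_contra! h
  simp only [toughSchools, lenientSchools, Finset.mem_filter, Finset.mem_univ, true_and,
    not_lt] at hs hs'
  have h1 := (strictMonoOn_lenientEffort hc hα hb).monotoneOn (σ.avgType_mem s')
    (σ.avgType_mem s) h
  have h2 := (strictAntiOn_toughEffort hc hα hb).antitoneOn (σ.avgType_mem s')
    (σ.avgType_mem s) h
  linarith

lemma effort_le_of_mem_tough (hc : IsCostFunction α c) (hα : α ∈ Ioo (0 : ℝ) 1)
    (hb : b ∈ Ioo (0 : ℝ) 1) {s : Fin σ.n} (hs : s ∈ σ.toughSchools c) :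
    σ.effort c s ≤ inducedEffort α c (toughReturn b) (σ.avgType s) := by
  simp only [toughSchools, Finset.mem_filter, Finset.mem_univ, true_and] at hs
  exact (effort_le_max hc hα hb σ s).trans_eq (max_eq_right hs.le)

lemma effort_le_of_mem_lenient (hc : IsCostFunction α c) (hα : α ∈ Ioo (0 : ℝ) 1)
    (hb : b ∈ Ioo (0 : ℝ) 1) {s : Fin σ.n} (hs : s ∈ σ.lenientSchools c) :
    σ.effort c s ≤ inducedEffort α c (lenientReturn b) (σ.avgType s) := by
  simp only [lenientSchools, Finset.mem_filter, Finset.mem_univ, true_and, not_lt] at hs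
  exact (effort_le_max hc hα hb σ s).trans_eq (max_eq_left hs)

/-- Equality in the termwise bound `effort ≤ inducedEffort`, from equality of total surpluses. -/
lemma effort_eq_of_sum_le (hc : IsCostFunction α c) (hα : α ∈ Ioo (0 : ℝ) 1)
    (hb : b ∈ Ioo (0 : ℝ) 1) {M : ℝ → ℝ} (hM : IsConcaveReturn M) {B : Finset (Fin σ.n)}
    (h : ∀ s ∈ B, σ.effort c s ≤ inducedEffort α c M (σ.avgType s))
    (hsum : ∑ s ∈ B, σ.mass s * inducedSurplus α c M (σ.avgType s)
      ≤ ∑ s ∈ B, σ.mass s * (σ.effort c s - c (σ.effort c s))) :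
    ∀ s ∈ B, σ.effort c s = inducedEffort α c M (σ.avgType s) := by
  intro s hs
  refine (h s hs).eq_of_not_lt fun hlt => hsum.not_gt ?_
  refine Finset.sum_lt_sum (fun s hs => ?_) ⟨s, hs, ?_⟩
  · exact mul_le_mul_of_nonneg_left (hM.surplus_le_inducedSurplus hc hα (σ.avgType_mem s)
      (effort_spec hc hα hb σ s).1.1 (h s hs)) (σ.mass_real_pos s).le
  · exact mul_lt_mul_of_pos_left (hM.surplus_lt_inducedSurplus hc hα (σ.avgType_mem s)
      (effort_spec hc hα hb σ s).1.1 hlt) (σ.mass_real_pos s)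

/-- At the top, lenient grading is strictly better than tough grading: otherwise the bottom
tier's effort under tough grading would exceed the top tier's effort. -/
lemma IsSortedAt.grading_lenient {t lo hi : ℝ} (h : σ.IsSortedAt c t lo hi) (hlt : lo < hi)
    (hc : IsCostFunction α c) (hα : α ∈ Ioo (0 : ℝ) 1) (hb : b ∈ Ioo (0 : ℝ) 1)
    (hlo : lo ∈ Ioo 0 α) (hhi : hi ∈ Ioo 0 α) {s : Fin σ.n} (hs : s ∈ σ.lenientSchools c) :
    σ.G s = GradingRule.lenient b hb := by
  have hL := isConcaveReturn_lenient hb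
  have hT := isConcaveReturn_tough hb
  have ha := h.avg_lenient s hs
  have he := h.effort_lenient s hs
  obtain ⟨h1, h2⟩ := effort_spec hc hα hb σ s
  rw [ha] at h2
  have hx := add_mem_Ioo_zero_one hhi h1
  have h3 : inducedEffort α c (toughReturn b) hi < σ.effort c s := by
    rw [he]
    exact (strictAntiOn_toughEffort hc hα hb hlo hhi hlt).trans_le h.effort_le
  have h4 := (hL.eq_inducedEffort_iff hc hα hhi h1).1 he
  rw [← not_le, hT.le_inducedEffort_iff hc hα hhi h1, not_le, h4, toughReturn,
    lenientReturn_lt_iff hb (sub_pos.2 hx.2) hx.1] at h3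
  exact (σ.G s).eq_lenient_of_marginalReturn_eq hb hx (by linarith) (by rw [← h2, h4])

lemma IsSortedAt.grading_tough {t lo hi : ℝ} (h : σ.IsSortedAt c t lo hi)
    (hc : IsCostFunction α c) (hα : α ∈ Ioo (0 : ℝ) 1) (hb : b ∈ Ioo (0 : ℝ) 1)
    (hlo : lo ∈ Ioo 0 α) {s : Fin σ.n} (hs : s ∈ σ.toughSchools c) :
    σ.G s = GradingRule.tough b hb := by
  have hL := isConcaveReturn_lenient hb
  have hT := isConcaveReturn_tough hb
  have ha := h.avg_tough s hs
  have he := h.effort_tough s hs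
  obtain ⟨h1, h2⟩ := effort_spec hc hα hb σ s
  rw [ha] at h2
  have hx := add_mem_Ioo_zero_one hlo h1
  have h3 : inducedEffort α c (lenientReturn b) lo < σ.effort c s := by
    simp only [toughSchools, Finset.mem_filter, Finset.mem_univ, true_and, ha] at hs
    rwa [he]
  have h4 := (hT.eq_inducedEffort_iff hc hα hlo h1).1 he
  rw [← not_le, hL.le_inducedEffort_iff hc hα hlo h1, not_le, h4, toughReturn,
    lenientReturn_lt_iff hb hx.1 (sub_pos.2 hx.2)] at h3
  exact (σ.G s).eq_tough_of_marginalReturn_eq hb hx (by linarith) (by rw [← h2, h4])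

variable [NullSingletonClass F]

/-- With both kinds of schools present, a cutoff system with the same mass of students below the
cutoff does at least as well as `σ`. Optimality of `σ` turns every inequality of the comparison
into an equality. -/
lemma ConstrainedOptimal.exists_isSortedAt (hσ : σ.ConstrainedOptimal c)
    (hc : IsCostFunction α c) (hα : α ∈ Ioo (0 : ℝ) 1) (hb : b ∈ Ioo (0 : ℝ) 1)
    (hF : F.support = Icc 0 α) (hT0 : (σ.toughSchools c).Nonempty)
    (hL0 : (σ.lenientSchools c).Nonempty) :
    ∃ t lo hi, lo ∈ Ioo 0 α ∧ hi ∈ Ioo 0 α ∧ lo < hi ∧ σ.IsSortedAt c t lo hi := by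
  have hL := isConcaveReturn_lenient hb
  have hT := isConcaveReturn_tough hb
  set B := σ.toughSchools c with hB
  set T := σ.lenientSchools c with hTdef
  have hmB : 0 < ∑ s ∈ B, σ.mass s := Finset.sum_pos (fun s _ => σ.mass_real_pos s) hT0
  have hmT : 0 < ∑ s ∈ T, σ.mass s := Finset.sum_pos (fun s _ => σ.mass_real_pos s) hL0
  have hm1 : ∑ s ∈ B, σ.mass s + ∑ s ∈ T, σ.mass s = 1 := by
    rw [hB, hTdef, sum_tough_add_sum_lenient, σ.sum_mass hF]
  obtain ⟨t, ht, hFt⟩ := exists_measureReal_Ioc_eq (F := F) hα.1 hF ⟨hmB, by linarith⟩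
  have hpt0 := measure_Ioc_pos hF le_rfl ht.2.le ht.1
  have hpt1 := measure_Ioo_pos hF ht.1.le le_rfl ht.2
  have hFt1 : F.real (Ioo t α) = ∑ s ∈ T, σ.mass s := by
    have : F.real (Ioc 0 t) + F.real (Ioo t α) = 1 := by
      rw [← measureReal_union disjoint_Ioc_Ioo measurableSet_Ioo, Ioc_union_Ioo_eq ht.1.le ht.2,
        measureReal_def, measure_Ioo_eq_one hF, ENNReal.toReal_one]
    linarith
  have hlo : conditionalMean F (Ioc 0 t) ∈ Ioo 0 α :=
    conditionalMean_mem measurableSet_Ioc (fun x hx => ⟨hx.1, hx.2.trans_lt ht.2⟩) hpt0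
  have hhi : conditionalMean F (Ioo t α) ∈ Ioo 0 α :=
    conditionalMean_mem measurableSet_Ioo (fun x hx => ⟨ht.1.trans hx.1, hx.2⟩) hpt1
  -- rearrangement: the actual mean of the tough schools' students is at least that below `t`
  set X := ⋃ s ∈ B, σ.students s with hX
  have hXm : MeasurableSet X := B.measurableSet_biUnion fun s _ => σ.measurableSet_students s
  have hXs : X ⊆ Ioo 0 α := iUnion₂_subset fun s _ => σ.students_subset s
  have hXF : F.real X = F.real (Ioc 0 t) := by rw [hX, σ.measureReal_biUnion_students, hFt]
  have hXi : ∫ θ in X, θ ∂F = ∑ s ∈ B, σ.mass s * σ.avgType s :=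
    σ.setIntegral_biUnion_students B
  have hre := setIntegral_Ioc_le hXm hXs hXF
  rw [hXi] at hre
  have hi0 := measureReal_mul_conditionalMean hpt0
  have hi1 := measureReal_mul_conditionalMean hpt1
  have hsplit : (∫ θ in Ioc 0 t, θ ∂F) + ∫ θ in Ioo t α, θ ∂F
      = ∑ s ∈ B, σ.mass s * σ.avgType s + ∑ s ∈ T, σ.mass s * σ.avgType s := by
    rw [← setIntegral_union disjoint_Ioc_Ioo measurableSet_Ioo
      (integrableOn_id_of_subset_Icc Ioc_subset_Icc_self)
      (integrableOn_id_of_subset_Icc Ioo_subset_Icc_self), Ioc_union_Ioo_eq ht.1.le ht.2,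
      hB, hTdef, sum_tough_add_sum_lenient, σ.sum_mass_mul_avgType]
  have hlohi : conditionalMean F (Ioc 0 t) < conditionalMean F (Ioo t α) := by
    refine lt_of_le_of_lt ?_ (conditionalMean_mem measurableSet_Ioo subset_rfl hpt1).1
    have := setIntegral_mono_on (integrableOn_id_of_subset_Icc (F := F) Ioc_subset_Icc_self)
      (integrableOn_const (C := t) (measure_ne_top F _)) measurableSet_Ioc
      fun x (hx : x ∈ Ioc 0 t) => hx.2
    rw [setIntegral_const, smul_eq_mul] at this
    rwa [conditionalMean, div_le_iff₀ (measureReal_pos_of_pos hpt0), mul_comm]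
  rw [hFt] at hi0
  rw [hFt1] at hi1
  set lo := conditionalMean F (Ioc 0 t) with hlodef
  set hi := conditionalMean F (Ioo t α) with hhidef
  set aB := (∑ s ∈ B, σ.mass s * σ.avgType s) / ∑ s ∈ B, σ.mass s with haB
  set aT := (∑ s ∈ T, σ.mass s * σ.avgType s) / ∑ s ∈ T, σ.mass s with haT
  have haBm : aB ∈ Ioo 0 α := by
    have : aB = conditionalMean F X := by
      rw [conditionalMean, hXi, hXF, hFt]
    rw [this]
    refine conditionalMean_mem hXm hXs ?_
    rw [measureReal_def, measureReal_def] at hXF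
    have := (ENNReal.toReal_eq_toReal_iff' (measure_ne_top _ _) (measure_ne_top _ _)).1 hXF
    rwa [this]
  have haTm : aT ∈ Ioo 0 α := by
    constructor
    · exact div_pos (Finset.sum_pos (fun s _ => mul_pos (σ.mass_real_pos s) (σ.avgType_mem s).1)
        hL0) hmT
    · rw [haT, div_lt_iff₀ hmT, Finset.mul_sum]
      exact Finset.sum_lt_sum_of_nonempty hL0 fun s _ => by
        rw [mul_comm]
        exact mul_lt_mul_of_pos_right (σ.avgType_mem s).2 (σ.mass_real_pos s)
  have hmBa : (∑ s ∈ B, σ.mass s) * aB = ∑ s ∈ B, σ.mass s * σ.avgType s :=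
    mul_div_cancel₀ _ hmB.ne'
  have hmTa : (∑ s ∈ T, σ.mass s) * aT = ∑ s ∈ T, σ.mass s * σ.avgType s :=
    mul_div_cancel₀ _ hmT.ne'
  have hloB : lo ≤ aB := le_of_mul_le_mul_left (by linarith) hmB
  have hThi : aT ≤ hi := le_of_mul_le_mul_left (by linarith) hmT
  -- surplus of the schools of each kind, bounded through Jensen and the rearrangement
  set VL := inducedSurplus α c (lenientReturn b) with hVL
  set VT := inducedSurplus α c (toughReturn b) with hVT
  have hΩ : ∑ s ∈ B, σ.mass s * (σ.effort c s - c (σ.effort c s))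
      + ∑ s ∈ T, σ.mass s * (σ.effort c s - c (σ.effort c s)) = σ.surplus c := by
    rw [hB, hTdef, sum_tough_add_sum_lenient, surplus]
  have heB : ∀ s ∈ B, σ.effort c s ≤ inducedEffort α c (toughReturn b) (σ.avgType s) :=
    fun s hs => effort_le_of_mem_tough hc hα hb hs
  have heT : ∀ s ∈ T, σ.effort c s ≤ inducedEffort α c (lenientReturn b) (σ.avgType s) :=
    fun s hs => effort_le_of_mem_lenient hc hα hb hs
  have h1 : ∑ s ∈ T, σ.mass s * (σ.effort c s - c (σ.effort c s))
      ≤ ∑ s ∈ T, σ.mass s * VL (σ.avgType s) :=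
    Finset.sum_le_sum fun s hs => mul_le_mul_of_nonneg_left
      (hL.surplus_le_inducedSurplus hc hα (σ.avgType_mem s) (effort_spec hc hα hb σ s).1.1
        (heT s hs)) (σ.mass_real_pos s).le
  have h4 : ∑ s ∈ B, σ.mass s * (σ.effort c s - c (σ.effort c s))
      ≤ ∑ s ∈ B, σ.mass s * VT (σ.avgType s) :=
    Finset.sum_le_sum fun s hs => mul_le_mul_of_nonneg_left
      (hT.surplus_le_inducedSurplus hc hα (σ.avgType_mem s) (effort_spec hc hα hb σ s).1.1
        (heB s hs)) (σ.mass_real_pos s).le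
  obtain ⟨h2, h2'⟩ := (hL.strictConcaveOn_inducedSurplus hc hα).sum_mul_le hL0
    (fun s _ => σ.mass_real_pos s) fun s _ => σ.avgType_mem s
  obtain ⟨h5, h5'⟩ := (hT.strictConcaveOn_inducedSurplus hc hα).sum_mul_le hT0
    (fun s _ => σ.mass_real_pos s) fun s _ => σ.avgType_mem s
  have h3 : VL aT ≤ VL hi :=
    (strictMonoOn_lenientSurplus hc hα hb).monotoneOn haTm hhi hThi
  have h6 : VT aB ≤ VT lo :=
    (strictAntiOn_toughSurplus hc hα hb).antitoneOn hlo haBm hloB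
  have h3' := mul_le_mul_of_nonneg_left h3 hmT.le
  have h6' := mul_le_mul_of_nonneg_left h6 hmB.le
  -- efforts in tough schools are below those in lenient schools, by incentive compatibility
  have h7 : ∑ s ∈ B, σ.mass s * (σ.effort c s - c (σ.effort c s))
      ≤ (∑ s ∈ B, σ.mass s) * VL hi := by
    rw [Finset.sum_mul]
    refine Finset.sum_le_sum fun s hs => mul_le_mul_of_nonneg_left ?_ (σ.mass_real_pos s).le
    refine le_of_mul_le_mul_left ?_ hmT
    refine le_trans ?_ (h1.trans (h2.trans h3'))
    rw [Finset.sum_mul]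
    refine Finset.sum_le_sum fun s' hs' => mul_le_mul_of_nonneg_left ?_ (σ.mass_real_pos s').le
    have hsp := effort_spec hc hα hb σ s'
    refine hc.surplus_le (effort_spec hc hα hb σ s).1.1 hsp.1.2 ?_ ?_
    · by_contra! hlt
      exact (hσ.1.avgType_le hc hα hb hlt).not_gt (avgType_lt_of_mem hc hα hb hs hs')
    · rw [hsp.2]
      exact ((σ.G s').marginalReturn_lt_one hb
        (add_mem_Ioo_zero_one (σ.avgType_mem s') hsp.1)).le
  rcases lt_or_ge (inducedEffort α c (lenientReturn b) hi) (inducedEffort α c (toughReturn b) lo)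
    with hcase | hcase
  · have := hσ.lenientSurplus_lt hc hα hb hF ht hcase
    have h8 : VL hi = (∑ s ∈ B, σ.mass s) * VL hi + (∑ s ∈ T, σ.mass s) * VL hi := by
      rw [← add_mul, hm1, one_mul]
    linarith
  · have hopt := hσ.cutoff_surplus_le hc hα hb hF ht
      (hT.inducedEffort_spec hc hα hlo).1.1 le_rfl hcase
    rw [hFt, hFt1] at hopt
    change (∑ s ∈ B, σ.mass s) * VT lo + (∑ s ∈ T, σ.mass s) * VL hi ≤ _ at hopt
    have hVeq : VL aT = VL hi := le_antisymm h3 (le_of_mul_le_mul_left (by linarith) hmT)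
    have haThi : aT = hi := (strictMonoOn_lenientSurplus hc hα hb).injOn haTm hhi hVeq
    have hVeq' : VT aB = VT lo := le_antisymm h6 (le_of_mul_le_mul_left (by linarith) hmB)
    have haBlo : aB = lo := (strictAntiOn_toughSurplus hc hα hb).injOn haBm hlo hVeq'
    have hav : ∀ s ∈ T, σ.avgType s = hi := fun s hs => haThi ▸ h2' (by linarith) s hs
    have hav' : ∀ s ∈ B, σ.avgType s = lo := fun s hs => haBlo ▸ h5' (by linarith) s hs
    refine ⟨t, lo, hi, hlo, hhi, hlohi, hav', hav, fun s hs => ?_, fun s hs => ?_, hcase, ?_⟩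
    · rw [← hav' s hs]
      exact effort_eq_of_sum_le hc hα hb hT heB (by linarith) s hs
    · rw [← hav s hs]
      exact effort_eq_of_sum_le hc hα hb hL heT (by linarith) s hs
    · refine ae_mem_iff_of_setIntegral_eq hXm hXs hXF ?_
      rw [hXi, ← hi0, ← hmBa, haBlo]

end SchoolSystem

end

theorem theorem3 (α b : ℝ) (hα : α ∈ Ioo (0 : ℝ) 1) (hb : b ∈ Ioo (0 : ℝ) 1)
    (c : ℝ → ℝ) (hc : IsCostFunction α c)
    (F : Measure ℝ) [IsProbabilityMeasure F] [NullSingletonClass F] (hF : F.support = Icc 0 α)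
    (σ : SchoolSystem α b F) (hσ : σ.ConstrainedOptimal c) :
    (σ.IsSingleTier ∨ σ.IsTwoTier) ∧
      ∀ S T : Set (Fin σ.n), σ.IsTwoTierWith S T →
        (∀ s ∈ T, σ.G s = GradingRule.lenient b hb) ∧
          (∀ s ∈ S, σ.G s = GradingRule.tough b hb) := by
  have hsingle : σ.IsSingleTier → (σ.IsSingleTier ∨ σ.IsTwoTier) ∧
      ∀ S T : Set (Fin σ.n), σ.IsTwoTierWith S T →
        (∀ s ∈ T, σ.G s = GradingRule.lenient b hb) ∧
          (∀ s ∈ S, σ.G s = GradingRule.tough b hb) := by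
    refine fun h => ⟨Or.inl h, fun S T hST => ?_⟩
    obtain ⟨s, hs⟩ := hST.bottom_nonempty
    obtain ⟨s', hs'⟩ := hST.top_nonempty
    exact absurd (h s s') (hST.avg_lt s hs s' hs').ne
  have hor : ∀ s, s ∈ σ.toughSchools c ∨ s ∈ σ.lenientSchools c := fun s => by
    simp only [SchoolSystem.toughSchools, SchoolSystem.lenientSchools, Finset.mem_filter,
      Finset.mem_univ, true_and]
    exact em _
  rcases (σ.toughSchools c).eq_empty_or_nonempty with hT0 | hT0
  · refine hsingle (hσ.isSingleTier_of_effort_le hc hα hb hF (isConcaveReturn_lenient hb)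
      (GradingRule.lenient b hb) (fun x hx => GradingRule.marginalReturn_lenient hb hx) fun s => ?_)
    exact SchoolSystem.effort_le_of_mem_lenient hc hα hb ((hor s).resolve_left (by simp [hT0]))
  rcases (σ.lenientSchools c).eq_empty_or_nonempty with hL0 | hL0
  · refine hsingle (hσ.isSingleTier_of_effort_le hc hα hb hF (isConcaveReturn_tough hb)
      (GradingRule.tough b hb) (fun x hx => GradingRule.marginalReturn_tough hb hx) fun s => ?_)
    exact SchoolSystem.effort_le_of_mem_tough hc hα hb ((hor s).resolve_right (by simp [hL0]))
  obtain ⟨t, lo, hi, hlo, hhi, hlt, h⟩ := hσ.exists_isSortedAt hc hα hb hF hT0 hL0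
  refine ⟨Or.inr ⟨_, _, h.isTwoTierWith hlt hT0 hL0⟩, fun S T hST => ?_⟩
  -- average types take only the values `lo` and `hi`, so the tiers of any two-tier structure are
  -- the tough and the lenient schools
  obtain ⟨s₀, hs₀⟩ := hST.bottom_nonempty
  obtain ⟨s₁, hs₁⟩ := hST.top_nonempty
  refine ⟨fun s hs => ?_, fun s hs => ?_⟩
  · refine h.grading_lenient hlt hc hα hb hlo hhi ((hor s).resolve_left fun hs' => ?_)
    have h1 := hST.avg_lt s₀ hs₀ s hs
    rw [h.avg_tough s hs'] at h1
    rcases hor s₀ with h2 | h2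
    · rw [h.avg_tough s₀ h2] at h1
      exact h1.false
    · rw [h.avg_lenient s₀ h2] at h1
      exact h1.not_gt hlt
  · refine h.grading_tough hc hα hb hlo ((hor s).resolve_right fun hs' => ?_)
    have h1 := hST.avg_lt s hs s₁ hs₁
    rw [h.avg_lenient s hs'] at h1
    rcases hor s₁ with h2 | h2
    · rw [h.avg_tough s₁ h2] at h1
      exact h1.not_gt hlt
    · rw [h.avg_lenient s₁ h2] at h1
      exact h1.false
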